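/- Let $n\ge 0$ and $W=S_n$, with simple reflections $s_i=(i\;\,i{+}1)$ for $1\le i<n$, length $\ell$, Bruhat order $\leqslant$ and long element $w_0(k)=n+1-k$. For $u\in W$ write $v\leqslant_u w$ if $u^{-1}v\leqslant u^{-1}w$. Let $\rho=(n-1,n-2,\dots,0)$, $\alpha_i=e_i-e_{i+1}$, $\Phi^+=\{e_p-e_q: p<q\}$, let $W$ act on $\mathbb Z^n$ by $we_k=e_{w(k)}$, put $\langle\alpha_i^\vee,\mu\rangle=\mu_i-\mu_{i+1}$, $\boldsymbol z^\mu=\prod_k z_k^{\mu_k}$, $\boldsymbol z_w=(z_{w(1)},\dots,z_{w(n)})$, $\boldsymbol z^{-1}=(z_1^{-1},\dots,z_n^{-1})$ and $r(\boldsymbol x;\boldsymbol y)=(-1)^{\ell(w_0)}\boldsymbol x^\rho\boldsymbol y^{-\rho}$. **The partition function.** Consider an $n\times n$ grid with rows numbered $1,\dots,n$ from top to bottom and columns numbered $1,\dots,n$ from right to left. Each horizontal edge carries at most one color from $\{1,\dots,n\}$ ($+$ denotes no color), each vertical edge carries a set of colors. For $\sigma,w\in W$, $Z^\square_{\sigma,w}(\boldsymbol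 x;\boldsymbol y)$ is the sum, over all decorations such that the top edge of column $j$ carries exactly the color $\sigma(j)$, the right edge of row $i$ carries $w(i)$, and the left and bottom boundary edges are uncolored, of the product over the vertices (row $i$, column $j$) of the following weights with $x=x_i$, $y=y_j$. Here $(\text{left},\text{top},\text{right},\text{bottom})$ are the decorations of the four edges at the vertex, $\Sigma$ is a set of colors, $c<d$ are colors, $\Sigma_{>c}$, $\Sigma_{<c}$, $\Sigma_{(c,d)}$ are the numbers of $e\in\Sigma$ with $e>c$, $e<c$, $c<e<d$, and all other configurations have weight $0$: * $(+,\Sigma,+,\Sigma)$: $(-t)^{|\Sigma|}$; * $(c,\Sigma,c,\Sigma)$: $t^{\Sigma_{>c}}(t^{[c\in\Sigma]}-x/y)$; * $(+,\Sigma,c,\Sigma\setminus\{c\})$ with $c\in\Sigma$: $(-t)^{\Sigma_{<c}}t^{\Sigma_{>c}}$; * $(c,\Sigma,+,\Sigma\cup\{c\})$ with $c\notin\Sigma$: $(t-1)\frac xy(-t)^{\Sigma_{>c}}$; * $(c,\Sigma,d,(\Sigma\cup\{c\})\setminus\{d\})$ with $c\notin\Sigma\ni d$: $(t-1)\frac xy(-t)^{\Sigma_{(c,d)}}t^{\Sigma_{>d}}$;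 * $(d,\Sigma,c,(\Sigma\cup\{d\})\setminus\{c\})$ with $d\notin\Sigma\ni c$: $(t-1)(-1)^{\Sigma_{(c,d)}}t^{\Sigma_{>d}}$. **The interpolated stab polynomials.** Put $t=q^{-1}$. In $\mathbb Z[q^{\pm1/2},\boldsymbol x^{\pm1},\boldsymbol y^{\pm1}]$ define, for $u,w\in W$, $$\mathrm{stab}_u(w)=(-1)^{\ell(uw_0)}q^{\ell(w_0)-\ell(w)/2}\,r(\boldsymbol x_{(uw_0)^{-1}};\boldsymbol y_u)\,Z^\square_{u,w}(\boldsymbol x^{-1};(\boldsymbol y_u)^{-1}).$$ On Laurent polynomials $f(\boldsymbol x;\boldsymbol y)$ define $$\overline\tau_i f=\frac{t-1}{1-\boldsymbol x^{-\alpha_i}}f(\boldsymbol x;\boldsymbol y)+\frac{\boldsymbol x^{-\alpha_i}-t}{1-\boldsymbol x^{-\alpha_i}}f(\boldsymbol x_{s_i};\boldsymbol y),\qquad M_i^u=q^{1/2}\boldsymbol x^{-w_0u^{-1}w_0\rho}\,\overline\tau_i\,\boldsymbol x^{w_0u^{-1}w_0\rho},$$ with values in the field of fractions, and the restriction $f|_v(\boldsymbol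 y)=f(\boldsymbol y_v;\boldsymbol y)$ for $v\in W$. **Proposition.** Let $u\in W$. (0) The family $\mathrm{stab}_u(w)$, $w\in W$, satisfies $$\mathrm{stab}_u(uw_0)=(-1)^{\ell(u)}q^{\ell(uw_0)/2}\,r(\boldsymbol x_{(uw_0)^{-1}};\boldsymbol x)\prod_{i+j\leqslant n}\Bigl(1-\frac{x_i}{y_{u(j)}}\Bigr)$$ and $\mathrm{stab}_u(ws_i)=M_i^u\,\mathrm{stab}_u(w)$ whenever $ws_i<w$; and it is the only family of Laurent polynomials with these two properties. (1) For all $v,w\in W$, $\mathrm{stab}_u(w)|_v=0$ unless $v\geqslant_u w$. (2) $\mathrm{stab}_u(uw_0)|_{uw_0}=q^{\ell(uw_0)/2}\prod_{\alpha\in\Phi^+}(1-\boldsymbol y^\alpha)$. (3) For all $v,w\in W$ and every simple reflection $s_i$, the restriction $\mathrm{stab}_u(ws_i)|_v$ equals $$\frac{q^{1/2}-q^{-1/2}}{\boldsymbol y^{-v\alpha_i}-1}\,\mathrm{stab}_u(w)|_v-\frac{q^{1/2}\boldsymbol y^{-v\alpha_i}-q^{-1/2}}{\boldsymbol y^{-v\alpha_i}-1}\,\boldsymbol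 y^{-\langle\alpha_i^\vee,w_0u^{-1}w_0\rho\rangle v\alpha_i}\,\mathrm{stab}_u(w)|_{vs_i}$$ if $ws_i<w$, and $$\frac{(q^{1/2}-q^{-1/2})\boldsymbol y^{-v\alpha_i}}{\boldsymbol y^{-v\alpha_i}-1}\,\mathrm{stab}_u(w)|_v-\frac{q^{1/2}\boldsymbol y^{-v\alpha_i}-q^{-1/2}}{\boldsymbol y^{-v\alpha_i}-1}\,\boldsymbol y^{-\langle\alpha_i^\vee,w_0u^{-1}w_0\rho\rangle v\alpha_i}\,\mathrm{stab}_u(w)|_{vs_i}$$ if $ws_i>w$ (identities in the field of fractions of $\mathbb Z[q^{\pm1/2},\boldsymbol y^{\pm1}]$). -/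

import Mathlib

open Equiv

namespace InterpolatedStab

noncomputable section

/-! ### The symmetric group -/

/-- The long element `k ↦ n + 1 - k` of the symmetric group. -/
def longElt (n : ℕ) : Perm (Fin n) := Fin.revPerm

/-- The simple reflection exchanging the neighbouring indices `i` and `i + 1`. -/
def simpleRefl {n : ℕ} (i : ℕ) (hi : i + 1 < n) : Perm (Fin n) :=
  Equiv.swap ⟨i, Nat.lt_of_succ_lt hi⟩ ⟨i + 1, hi⟩

/-- The length of a permutation: its number of inversions. -/
def len {n : ℕ} (w : Perm (Fin n)) : ℕ :=
  (Finset.univ.filter fun p : Fin n × Fin n => p.1 < p.2 ∧ w p.2 < w p.1).card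

/-- An elementary step of the Bruhat order: multiplication by a reflection that
increases the length. -/
def BruhatStep {n : ℕ} (v w : Perm (Fin n)) : Prop :=
  ∃ i j : Fin n, w = v * Equiv.swap i j ∧ len v < len w

/-- The (strong) Bruhat order `v ≤ w`. -/
def BruhatLE {n : ℕ} (v w : Perm (Fin n)) : Prop := Relation.ReflTransGen BruhatStep v w

/-- The strict Bruhat order `v < w`. -/
def BruhatLT {n : ℕ} (v w : Perm (Fin n)) : Prop := Relation.TransGen BruhatStep v w

/-- The `u`-Bruhat order: `v ≤_u w` means `u⁻¹ v ≤ u⁻¹ w`. -/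
def TwistedBruhatLE {n : ℕ} (u v w : Perm (Fin n)) : Prop := BruhatLE (u⁻¹ * v) (u⁻¹ * w)

/-! ### Weights and roots of `GL(n)` -/

/-- The weight lattice `ℤⁿ`. -/
abbrev Weight (n : ℕ) : Type := Fin n → ℤ

/-- The action of permutations on weights, `w e_k = e_{w(k)}`. -/
def act {n : ℕ} (w : Perm (Fin n)) (μ : Weight n) : Weight n := fun k => μ (w⁻¹ k)

/-- The Weyl vector `ρ = (n - 1, n - 2, …, 0)`. -/
def weylVec (n : ℕ) : Weight n := fun k => (n : ℤ) - 1 - ((k : ℕ) : ℤ)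

/-- The root `e_p - e_q`; it is positive when `p < q`. -/
def root {n : ℕ} (p q : Fin n) : Weight n := Pi.single p 1 - Pi.single q 1

/-- The simple root `α_i = e_i - e_{i+1}`. -/
def simpleRoot {n : ℕ} (i : ℕ) (hi : i + 1 < n) : Weight n :=
  root ⟨i, Nat.lt_of_succ_lt hi⟩ ⟨i + 1, hi⟩

/-- The pairing `⟨α_i^∨, μ⟩ = μ_i - μ_{i+1}`. -/
def corootPairing {n : ℕ} (i : ℕ) (hi : i + 1 < n) (μ : Weight n) : ℤ :=
  μ ⟨i, Nat.lt_of_succ_lt hi⟩ - μ ⟨i + 1, hi⟩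

/-- The weight `w₀ u⁻¹ w₀ ρ`. -/
def twistedRho {n : ℕ} (u : Perm (Fin n)) : Weight n :=
  act (longElt n * u⁻¹ * longElt n) (weylVec n)

/-- The monomial `z^μ = ∏ z_k^{μ_k}`. -/
def monomial {n : ℕ} {R : Type*} [CommRing R] (z : Fin n → Rˣ) (μ : Weight n) : Rˣ :=
  ∏ k, z k ^ μ k

/-- `r(x; y) = (-1)^{ℓ(w₀)} x^ρ y^{-ρ}`. -/
def rFactor {n : ℕ} {R : Type*} [CommRing R] (x y : Fin n → Rˣ) : Rˣ :=
  (-1) ^ len (longElt n) * monomial x (weylVec n) * monomial y (-weylVec n)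

/-! ### The lattice model -/

/-- The Boltzmann weight of a vertex with row parameter `x` and column parameter `y`.
Colors are the elements of `Fin n` in their usual order. A horizontal edge carries at most one
color (`none` is the uncolored edge), a vertical edge carries a set of colors. Configurations
that are not admissible have weight `0`. -/
def boltzmann {n : ℕ} {R : Type*} [CommRing R] (t : R) (x y : Rˣ)
    (left : Option (Fin n)) (top : Finset (Fin n))
    (right : Option (Fin n)) (bottom : Finset (Fin n)) : R :=
  match left, right with
  | none, none => if bottom = top then (-t) ^ top.card else 0
  | none, some c =>
      if c ∈ top ∧ bottom = top.erase c then
        (-t) ^ (top.filter (· < c)).card * t ^ (top.filter (c < ·)).card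
      else 0
  | some c, none =>
      if c ∉ top ∧ bottom = insert c top then
        (t - 1) * (x * y⁻¹ : Rˣ) * (-t) ^ (top.filter (c < ·)).card
      else 0
  | some c, some d =>
      if c = d then
        if bottom = top then
          t ^ (top.filter (c < ·)).card * ((if c ∈ top then t else 1) - (x * y⁻¹ : Rˣ))
        else 0
      else if c ∉ top ∧ d ∈ top ∧ bottom = insert c (top.erase d) then
        if c < d then
          (t - 1) * (x * y⁻¹ : Rˣ) * (-t) ^ (top.filter fun e => c < e ∧ e < d).card
            * t ^ (top.filter (d < ·)).card
        else
          (t - 1) * (-1) ^ (top.filter fun e => d < e ∧ e < c).card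
            * t ^ (top.filter (c < ·)).card
      else 0

/-- A decorated `n × n` lattice: decorations of the horizontal edges (`.1`) and of the vertical
edges (`.2`). Rows are numbered from top to bottom and columns from right to left. The vertex in
row `i` and column `j` has right edge `.1 i j.castSucc`, left edge `.1 i j.succ`, top edge
`.2 i.castSucc j` and bottom edge `.2 i.succ j`. -/
abbrev DecoratedLattice (n : ℕ) : Type :=
  (Fin n → Fin (n + 1) → Option (Fin n)) × (Fin (n + 1) → Fin n → Finset (Fin n))

/-- The boundary conditions for `(σ, w)` and the partition `(n, n - 1, …, 1)`: the top edge of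
column `j` carries exactly the color `σ(j)`, the right edge of row `i` carries the color `w(i)`,
and the bottom and left boundary edges are uncolored. -/
def IsBoundary {n : ℕ} (σ w : Perm (Fin n)) (S : DecoratedLattice n) : Prop :=
  (∀ j, S.2 0 j = {σ j}) ∧ (∀ j, S.2 (Fin.last n) j = ∅) ∧
    (∀ i, S.1 i 0 = some (w i)) ∧ (∀ i, S.1 i (Fin.last n) = none)

open Classical in
/-- The partition function `Z^□_{σ,w}(x; y)` with deformation parameter `t`. -/
def partitionFn {n : ℕ} {R : Type*} [CommRing R] (t : R) (x y : Fin n → Rˣ)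
    (σ w : Perm (Fin n)) : R :=
  ∑ S ∈ (Finset.univ : Finset (DecoratedLattice n)).filter (IsBoundary σ w),
    ∏ i : Fin n, ∏ j : Fin n,
      boltzmann t (x i) (y j) (S.1 i j.succ) (S.2 i.castSucc j) (S.1 i j.castSucc) (S.2 i.succ j)

/-! ### Laurent polynomials -/

/-- The ring of Laurent polynomials with integer coefficients in the variables `σ`, as the group
ring of the lattice of exponents. -/
abbrev Laurent (σ : Type) : Type := AddMonoidAlgebra ℤ (σ →₀ ℤ)

/-- A variable, as an invertible Laurent polynomial. -/
def gen {σ : Type} (a : σ) : (Laurent σ)ˣ where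
  val := AddMonoidAlgebra.single (Finsupp.single a 1) 1
  inv := AddMonoidAlgebra.single (Finsupp.single a (-1)) 1
  val_inv := by
    rw [AddMonoidAlgebra.single_mul_single, ← Finsupp.single_add]
    simp [AddMonoidAlgebra.one_def]
  inv_val := by
    rw [AddMonoidAlgebra.single_mul_single, ← Finsupp.single_add]
    simp [AddMonoidAlgebra.one_def]

/-- The substitution of variables for variables. -/
def rename {σ τ : Type} (f : σ → τ) : Laurent σ →+* Laurent τ :=
  AddMonoidAlgebra.mapDomainRingHom ℤ (Finsupp.mapDomain.addMonoidHom f)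

/-- The variables of `ℤ[q^{±1/2}, x₁^{±1}, …, xₙ^{±1}, y₁^{±1}, …, yₙ^{±1}]`. -/
inductive VarXY (n : ℕ) : Type
  | sqrtq : VarXY n
  | x : Fin n → VarXY n
  | y : Fin n → VarXY n

/-- The variables of `ℤ[q^{±1/2}, y₁^{±1}, …, yₙ^{±1}]`. -/
inductive VarY (n : ℕ) : Type
  | sqrtq : VarY n
  | y : Fin n → VarY n

/-- `ℤ[q^{±1/2}, x^{±1}, y^{±1}]` -/
abbrev LXY (n : ℕ) : Type := Laurent (VarXY n)

/-- `ℤ[q^{±1/2}, y^{±1}]` -/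
abbrev LY (n : ℕ) : Type := Laurent (VarY n)

/-- The field of fractions of `ℤ[q^{±1/2}, x^{±1}, y^{±1}]`. -/
abbrev FXY (n : ℕ) : Type := FractionRing (LXY n)

/-- The field of fractions of `ℤ[q^{±1/2}, y^{±1}]`. -/
abbrev FY (n : ℕ) : Type := FractionRing (LY n)

/-- `q^{1/2}` in `ℤ[q^{±1/2}, x^{±1}, y^{±1}]` -/
def qh (n : ℕ) : (LXY n)ˣ := gen VarXY.sqrtq

/-- The variables `x₁, …, xₙ`. -/
def xv {n : ℕ} (i : Fin n) : (LXY n)ˣ := gen (VarXY.x i)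

/-- The variables `y₁, …, yₙ` of `ℤ[q^{±1/2}, x^{±1}, y^{±1}]`. -/
def yv {n : ℕ} (j : Fin n) : (LXY n)ˣ := gen (VarXY.y j)

/-- `q^{1/2}` in `ℤ[q^{±1/2}, y^{±1}]` -/
def qhY (n : ℕ) : (LY n)ˣ := gen VarY.sqrtq

/-- The variables `y₁, …, yₙ` of `ℤ[q^{±1/2}, y^{±1}]`. -/
def yY {n : ℕ} (j : Fin n) : (LY n)ˣ := gen (VarY.y j)

/-- The action of `w` on the `x` variables, `(w · f)(x; y) = f(x_{w(1)}, …, x_{w(n)}; y)`. -/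
def permX {n : ℕ} (w : Perm (Fin n)) : LXY n →+* LXY n :=
  rename fun a => match a with
    | .sqrtq => .sqrtq
    | .x i => .x (w i)
    | .y j => .y j

/-- The restriction `f|_v(y) = f(y_{v(1)}, …, y_{v(n)}; y₁, …, yₙ)`. -/
def restrict {n : ℕ} (v : Perm (Fin n)) : LXY n →+* LY n :=
  rename fun a => match a with
    | .sqrtq => .sqrtq
    | .x i => .y (v i)
    | .y j => .y j

/-! ### Interpolated stab polynomials and their recursion operators -/

/-- The interpolated stab polynomial
`stab_u(w) = (-1)^{ℓ(u w₀)} q^{ℓ(w₀) - ℓ(w)/2} r(x_{(u w₀)⁻¹}; y_u) Z^□_{u,w}(x⁻¹; (y_u)⁻¹)`,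
where the partition function is taken at `t = q⁻¹`, and `z_w = (z_{w(1)}, …, z_{w(n)})`. -/
def stab {n : ℕ} (u w : Perm (Fin n)) : LXY n :=
  (-1) ^ len (u * longElt n)
    * (qh n ^ (2 * (len (longElt n) : ℤ) - (len w : ℤ)) : (LXY n)ˣ)
    * (rFactor (fun i => xv ((u * longElt n)⁻¹ i)) (fun j => yv (u j)) : (LXY n)ˣ)
    * partitionFn ((qh n ^ (-2 : ℤ) : (LXY n)ˣ) : LXY n)
        (fun i => (xv i)⁻¹) (fun j => (yv (u j))⁻¹) u w

/-- The operator
`τ̄_i f = (t - 1) / (1 - x^{-α_i}) f + (x^{-α_i} - t) / (1 - x^{-α_i}) (s_i · f)`, with `t = q⁻¹`,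
on Laurent polynomials. -/
def tauBar {n : ℕ} (i : ℕ) (hi : i + 1 < n) (f : LXY n) : FXY n :=
  let t : FXY n := algebraMap (LXY n) (FXY n) (qh n ^ (-2 : ℤ) : (LXY n)ˣ)
  let X : FXY n := algebraMap (LXY n) (FXY n) (monomial xv (-simpleRoot i hi) : (LXY n)ˣ)
  (t - 1) / (1 - X) * algebraMap (LXY n) (FXY n) f
    + (X - t) / (1 - X) * algebraMap (LXY n) (FXY n) (permX (simpleRefl i hi) f)

/-- The operator `M_i^u = q^{1/2} x^{-w₀ u⁻¹ w₀ ρ} τ̄_i x^{w₀ u⁻¹ w₀ ρ}`. -/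
def opM {n : ℕ} (u : Perm (Fin n)) (i : ℕ) (hi : i + 1 < n) (f : LXY n) : FXY n :=
  algebraMap (LXY n) (FXY n) (qh n * monomial xv (-twistedRho u) : (LXY n)ˣ)
    * tauBar i hi ((monomial xv (twistedRho u) : (LXY n)ˣ) * f)

/-- The base value
`(-1)^{ℓ(u)} q^{ℓ(u w₀)/2} r(x_{(u w₀)⁻¹}; x) ∏_{i + j ≤ n} (1 - x_i / y_{u(j)})`
(with indices `i, j` starting from `1`). -/
def baseValue {n : ℕ} (u : Perm (Fin n)) : LXY n :=
  (-1) ^ len u * (qh n : LXY n) ^ len (u * longElt n)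
    * (rFactor (fun i => xv ((u * longElt n)⁻¹ i)) xv : (LXY n)ˣ)
    * ∏ p ∈ Finset.univ.filter
          (fun p : Fin n × Fin n => ((p.1 : ℕ) + 1) + ((p.2 : ℕ) + 1) ≤ n),
        (1 - ((xv p.1 * (yv (u p.2))⁻¹ : (LXY n)ˣ) : LXY n))

/-- `stab_u(w)|_v`, as an element of the field of fractions of `ℤ[q^{±1/2}, y^{±1}]`. -/
def stabRes {n : ℕ} (u w v : Perm (Fin n)) : FY n :=
  algebraMap (LY n) (FY n) (restrict v (stab u w))

/-- `q^{1/2}`, as an element of the field of fractions of `ℤ[q^{±1/2}, y^{±1}]`. -/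
def qF (n : ℕ) : FY n := algebraMap (LY n) (FY n) (qhY n)

/-- `y^μ`, as an element of the field of fractions of `ℤ[q^{±1/2}, y^{±1}]`. -/
def yF {n : ℕ} (μ : Weight n) : FY n := algebraMap (LY n) (FY n) (monomial yY μ : (LY n)ˣ)

end

end InterpolatedStab

open InterpolatedStab

/-! Everything follows from one exchange relation for the partition function and one explicit value.

Exchange relation. For `w(i+1) < w(i)`, the value at `w s_i` is a linear combination of the value at
`w` and of the value at `w` with `x_i` and `x_{i+1}` interchanged (`partitionFn_exchange`). Only
rows `i` and `i+1` are affected, so this is a statement about two rows with prescribed right edges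
and uncolored left edges. It is proved by induction on the number of columns
(`twoRowWeight_exchange`), a Yang–Baxter argument in linear form. The left boundary is trivial, and
adding a column on the right preserves the relation. For a single column the vertex weights factor
(`vertexWeight_eq`): each color passing vertically contributes a factor for the left edge and a
factor for the right edge, and the rest is a core weight. The passing colors give the same factor in
all terms, so what remains is a finite list of rational identities, one for each relative order of
the at most four colors on the horizontal edges (`coreWeight₂_exchange`). Since each color enters
only once at the top, colors never coincide on these edges where the weight is nonzero.

Recursion and base value. The prefactor of `stab` has a monomial whose exponent is, up to a constant
vector, the negative of `w₀ u⁻¹ w₀ ρ`. This turns the exchange relation into `stab_u(w s_i) = M_i^u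
stab_u(w)` (`stab_stepRel`, in the form `StepRel` without denominators). For `w = u w₀` the lattice
has a single state, which gives the product formula (`partitionFn_mul_longElt`).

Consequences. The operator can be inverted by a Hecke quadratic relation (`StepRel.reverse`), so the
recursion runs in both directions. Hence the base value determines the whole family, and restriction
to `x = y_v` gives both recurrences. For the vanishing, the product at `u w₀` restricts to zero at
every `v ≠ u w₀`; the recurrence relates the restriction at `v` to those at `v` and `v s_i`, and the
lifting property of the Bruhat order propagates the zeros. The value at `u w₀` itself is a
Vandermonde product up to monomials and signs. -/

namespace InterpolatedStab

noncomputable section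

/-! ### Length and Bruhat order -/

/-- The inversions of a permutation. -/
def inversions {n : ℕ} (w : Perm (Fin n)) : Finset (Fin n × Fin n) :=
  Finset.univ.filter fun p : Fin n × Fin n => p.1 < p.2 ∧ w p.2 < w p.1

lemma mem_inversions {n : ℕ} {w : Perm (Fin n)} {p : Fin n × Fin n} :
    p ∈ inversions w ↔ p.1 < p.2 ∧ w p.2 < w p.1 := by
  simp [inversions]

lemma len_eq {n : ℕ} (w : Perm (Fin n)) : len w = (inversions w).card := rfl

/-- Inversions of `x` inject into those of `x s`: move a pair by `s` when `s` keeps its order, and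
leave it alone otherwise. A pair whose order `s` reverses involves `a` or `b` and a position between
them, and stays an inversion because `x a < x b`. The pair `(a, b)` is a new inversion outside the
image. -/
lemma len_lt_len_mul_swap {n : ℕ} (x : Perm (Fin n)) {a b : Fin n} (hab : a < b)
    (h : x a < x b) : len x < len (x * swap a b) := by
  classical
  set s := swap a b with hs
  have hss : ∀ k, s (s k) = k := fun k => swap_apply_self a b k
  let φ : Fin n × Fin n → Fin n × Fin n :=
    fun p => if s p.1 < s p.2 then (s p.1, s p.2) else p
  have hinj : Set.InjOn φ (inversions x : Set (Fin n × Fin n)) := by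
    rintro ⟨p, q⟩ hp ⟨p', q'⟩ hp' e
    have hp := (mem_inversions.1 hp).1
    have hp' := (mem_inversions.1 hp').1
    simp only [φ] at e hp hp'
    split_ifs at e with h1 h2 h2
    · simpa using e
    · obtain ⟨e1, e2⟩ := Prod.mk.inj e
      rw [← e1, ← e2, hss, hss] at h2
      exact absurd hp h2
    · obtain ⟨e1, e2⟩ := Prod.mk.inj e
      rw [e1, e2, hss, hss] at h1
      exact absurd hp' h1
    · exact e
  have hsub : (inversions x).image φ ⊂ inversions (x * s) := by
    refine Finset.ssubset_iff_subset_ne.2 ⟨?_, ?_⟩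
    · intro r hr
      obtain ⟨⟨p, q⟩, hp, rfl⟩ := Finset.mem_image.1 hr
      obtain ⟨h1, h2⟩ := mem_inversions.1 hp
      simp only at h1 h2
      by_cases hlt : s p < s q
      · simp only [φ, if_pos hlt, mem_inversions, Perm.mul_apply, hss]
        exact ⟨hlt, h2⟩
      · simp only [φ, if_neg hlt, mem_inversions, Perm.mul_apply]
        refine ⟨h1, ?_⟩
        rw [hs] at hlt ⊢
        rw [swap_apply_def, swap_apply_def] at hlt
        rw [swap_apply_def, swap_apply_def]
        split_ifs at hlt ⊢ <;> subst_vars <;> order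
    · intro e
      have hm : (a, b) ∈ inversions (x * s) := by
        simp [mem_inversions, hs, hab, h]
      rw [← e] at hm
      obtain ⟨⟨p, q⟩, hp, hpq⟩ := Finset.mem_image.1 hm
      obtain ⟨h1, h2⟩ := mem_inversions.1 hp
      simp only at h1 h2
      simp only [φ] at hpq
      split_ifs at hpq with hlt
      · obtain ⟨e1, e2⟩ := Prod.mk.inj hpq
        have e1' : p = b := by rw [← hss p, e1, hs, swap_apply_left]
        have e2' : q = a := by rw [← hss q, e2, hs, swap_apply_right]
        subst e1' e2'
        order
      · obtain ⟨rfl, rfl⟩ := Prod.mk.inj hpq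
        order
  have := Finset.card_lt_card hsub
  rwa [Finset.card_image_of_injOn hinj] at this

lemma len_mul_swap_lt_len {n : ℕ} (x : Perm (Fin n)) {a b : Fin n} (hab : a < b)
    (h : x b < x a) : len (x * swap a b) < len x := by
  have := len_lt_len_mul_swap (x * swap a b) hab (by simpa using h)
  rwa [mul_assoc, swap_mul_self, mul_one] at this

lemma len_lt_len_mul_swap_iff {n : ℕ} (x : Perm (Fin n)) {a b : Fin n} (hab : a < b) :
    len x < len (x * swap a b) ↔ x a < x b := by
  refine ⟨fun h => ?_, len_lt_len_mul_swap x hab⟩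
  by_contra hc
  have hne : x a ≠ x b := x.injective.ne hab.ne
  have := len_mul_swap_lt_len x hab (lt_of_le_of_ne (not_lt.1 hc) hne.symm)
  omega

lemma len_lt_of_bruhatLT {n : ℕ} {v w : Perm (Fin n)} (h : BruhatLT v w) : len v < len w := by
  induction h with
  | single h => exact h.choose_spec.choose_spec.2
  | tail _ h ih => obtain ⟨i, j, _, h⟩ := h; omega

/-! ### Simple reflections and the lifting property -/

section SimpleReflections

variable {n i : ℕ} (hi : i + 1 < n)

lemma simpleRefl_mul_self : simpleRefl i hi * simpleRefl i hi = 1 := swap_mul_self _ _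

lemma mul_simpleRefl_mul_simpleRefl (w : Perm (Fin n)) :
    w * simpleRefl i hi * simpleRefl i hi = w := by
  rw [mul_assoc, simpleRefl_mul_self, mul_one]

lemma simpleRefl_simpleRefl (k : Fin n) : simpleRefl i hi (simpleRefl i hi k) = k :=
  swap_apply_self _ _ k

lemma simpleRefl_left : simpleRefl i hi ⟨i, Nat.lt_of_succ_lt hi⟩ = ⟨i + 1, hi⟩ :=
  swap_apply_left _ _

lemma simpleRefl_right : simpleRefl i hi ⟨i + 1, hi⟩ = ⟨i, Nat.lt_of_succ_lt hi⟩ :=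
  swap_apply_right _ _

lemma simpleRefl_of_ne {k : Fin n} (h1 : (k : ℕ) ≠ i) (h2 : (k : ℕ) ≠ i + 1) :
    simpleRefl i hi k = k :=
  swap_apply_of_ne_of_ne (fun h => h1 (by rw [h])) (fun h => h2 (by rw [h]))

lemma simpleRefl_lt_simpleRefl {p q : Fin n} (hpq : p < q) (h : ¬((p : ℕ) = i ∧ (q : ℕ) = i + 1)) :
    simpleRefl i hi p < simpleRefl i hi q := by
  simp only [simpleRefl, swap_apply_def, Fin.ext_iff, Fin.lt_def] at *
  split_ifs <;> simp_all <;> omega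

lemma len_lt_len_mul_simpleRefl_iff (w : Perm (Fin n)) :
    len w < len (w * simpleRefl i hi) ↔ w ⟨i, Nat.lt_of_succ_lt hi⟩ < w ⟨i + 1, hi⟩ :=
  len_lt_len_mul_swap_iff w (by simp [Fin.lt_def])

/-- A simple reflection keeps the order of every pair of positions except `(i, i + 1)`, so it
transports all inversions and creates exactly this one. -/
lemma len_mul_simpleRefl_of_lt (w : Perm (Fin n))
    (h : w ⟨i, Nat.lt_of_succ_lt hi⟩ < w ⟨i + 1, hi⟩) :
    len (w * simpleRefl i hi) = len w + 1 := by
  classical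
  set s := simpleRefl i hi
  have hss : ∀ k, s (s k) = k := simpleRefl_simpleRefl hi
  have e : inversions (w * s) = insert (⟨i, Nat.lt_of_succ_lt hi⟩, ⟨i + 1, hi⟩)
      ((inversions w).image fun p => (s p.1, s p.2)) := by
    ext ⟨p, q⟩
    rw [Finset.mem_insert, Finset.mem_image]
    constructor
    · intro hp
      obtain ⟨h1, h2⟩ := mem_inversions.1 hp
      by_cases hpq : (p : ℕ) = i ∧ (q : ℕ) = i + 1
      · left
        exact Prod.ext (Fin.ext hpq.1) (Fin.ext hpq.2)
      · right
        exact ⟨(s p, s q), mem_inversions.2 ⟨simpleRefl_lt_simpleRefl hi h1 hpq, h2⟩, by simp [hss]⟩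
    · rintro (hp | ⟨⟨p', q'⟩, hp, e⟩)
      · obtain ⟨rfl, rfl⟩ := Prod.mk.inj hp
        simp only [mem_inversions, Perm.mul_apply, s, simpleRefl_left, simpleRefl_right]
        exact ⟨by simp [Fin.lt_def], h⟩
      · obtain ⟨rfl, rfl⟩ := Prod.mk.inj e
        obtain ⟨h1, h2⟩ := mem_inversions.1 hp
        simp only at h1 h2
        simp only [mem_inversions, Perm.mul_apply, hss]
        refine ⟨simpleRefl_lt_simpleRefl hi h1 ?_, h2⟩
        rintro ⟨e1, e2⟩
        have e1' : p' = ⟨i, Nat.lt_of_succ_lt hi⟩ := Fin.ext e1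
        have e2' : q' = ⟨i + 1, hi⟩ := Fin.ext e2
        subst e1' e2'
        order
  rw [len_eq, e, Finset.card_insert_of_notMem, Finset.card_image_of_injective, len_eq]
  · rintro ⟨p, q⟩ ⟨p', q'⟩ e
    simpa using e
  · intro hm
    obtain ⟨⟨p, q⟩, hp, e⟩ := Finset.mem_image.1 hm
    obtain ⟨e1, e2⟩ := Prod.mk.inj e
    have e1' : p = ⟨i + 1, hi⟩ := by rw [← hss p, e1]; exact simpleRefl_left hi
    have e2' : q = ⟨i, Nat.lt_of_succ_lt hi⟩ := by rw [← hss q, e2]; exact simpleRefl_right hi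
    have := (mem_inversions.1 hp).1
    rw [e1', e2'] at this
    simp [Fin.lt_def] at this

lemma bruhatLT_mul_simpleRefl_iff (w : Perm (Fin n)) :
    BruhatLT w (w * simpleRefl i hi) ↔ w ⟨i, Nat.lt_of_succ_lt hi⟩ < w ⟨i + 1, hi⟩ := by
  rw [← len_lt_len_mul_simpleRefl_iff]
  exact ⟨len_lt_of_bruhatLT, fun h => .single ⟨_, _, rfl, h⟩⟩

lemma bruhatLT_of_mul_simpleRefl_iff (w : Perm (Fin n)) :
    BruhatLT (w * simpleRefl i hi) w ↔ w ⟨i + 1, hi⟩ < w ⟨i, Nat.lt_of_succ_lt hi⟩ := by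
  have := bruhatLT_mul_simpleRefl_iff hi (w * simpleRefl i hi)
  rwa [mul_simpleRefl_mul_simpleRefl, Perm.mul_apply, Perm.mul_apply, simpleRefl_left,
    simpleRefl_right] at this

/-- The shorter of `x` and `x s_i`. -/
def lower (x : Perm (Fin n)) : Perm (Fin n) :=
  if len (x * simpleRefl i hi) < len x then x * simpleRefl i hi else x

lemma bruhatLE_of_len_lt (x : Perm (Fin n)) (h : len (x * simpleRefl i hi) < len x) :
    BruhatLE (x * simpleRefl i hi) x :=
  .single ⟨_, _, (mul_simpleRefl_mul_simpleRefl hi x).symm, h⟩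

lemma lower_bruhatLE (x : Perm (Fin n)) : BruhatLE (lower hi x) x := by
  unfold lower
  split_ifs with h
  · exact bruhatLE_of_len_lt hi x h
  · exact .refl

lemma lower_mul_simpleRefl (x : Perm (Fin n)) : lower hi (x * simpleRefl i hi) = lower hi x := by
  unfold lower
  rw [mul_simpleRefl_mul_simpleRefl]
  have hne : len x ≠ len (x * simpleRefl i hi) := by
    rcases lt_trichotomy (x ⟨i, Nat.lt_of_succ_lt hi⟩) (x ⟨i + 1, hi⟩) with h | h | h
    · exact ((len_lt_len_mul_simpleRefl_iff hi x).2 h).ne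
    · simpa using x.injective h
    · exact (len_mul_swap_lt_len x (by simp [Fin.lt_def]) h).ne'
  split_ifs with h1 h2 h2
  · omega
  · rfl
  · rfl
  · omega

/-- Right multiplication by a simple reflection maps a Bruhat step to a Bruhat step, unless it
exchanges its ends. -/
lemma BruhatStep.mul_simpleRefl {x y : Perm (Fin n)} (h : BruhatStep x y) :
    y = x * simpleRefl i hi ∨ BruhatStep (x * simpleRefl i hi) (y * simpleRefl i hi) := by
  have key : ∀ a b : Fin n, a < b → y = x * swap a b → len x < len y →
      y = x * simpleRefl i hi ∨ BruhatStep (x * simpleRefl i hi) (y * simpleRefl i hi) := by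
    intro a b hab hy hlt
    by_cases hs : (a : ℕ) = i ∧ (b : ℕ) = i + 1
    · left
      rw [hy, simpleRefl]
      congr 2
      · exact Fin.ext hs.1
      · exact Fin.ext hs.2
    · right
      -- Conjugation by `s` turns the reflection in `a`, `b` into the one in `s a`, `s b`. Since `s`
      -- keeps `a < b` and the values compared are still `x a` and `x b`, the length still
      -- increases.
      set s := simpleRefl i hi with hsdef
      have e : y * s = x * s * swap (s a) (s b) := by
        have := Equiv.swap_apply_apply s a b
        rw [this, hy]
        have hinv : s⁻¹ = s := by rw [hsdef, simpleRefl, swap_inv]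
        simp only [hinv]
        rw [mul_assoc, mul_assoc x s, ← mul_assoc s (s * swap a b), ← mul_assoc s s, hsdef,
          simpleRefl_mul_self, one_mul]
      refine ⟨s a, s b, e, ?_⟩
      rw [e, len_lt_len_mul_swap_iff _ (simpleRefl_lt_simpleRefl hi hab hs)]
      rw [hy, len_lt_len_mul_swap_iff _ hab] at hlt
      simpa [hsdef, simpleRefl_simpleRefl] using hlt
  obtain ⟨a, b, hy, hlt⟩ := h
  rcases lt_trichotomy a b with hab | rfl | hab
  · exact key a b hab hy hlt
  · rw [hy, swap_self] at hlt
    exact absurd hlt (lt_irrefl _)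
  · exact key b a hab (by rw [hy, swap_comm]) hlt

/-- For one step from `y` to `z`, either `z = y s` and the two lower elements agree, or the step
survives multiplication by `s`. Then `lower y` is below both `z` and `z s`, one of which is `lower
z`. -/
lemma bruhatLE_lower {x y : Perm (Fin n)} (h : BruhatLE x y) :
    BruhatLE (lower hi x) (lower hi y) := by
  induction h with
  | refl => exact .refl
  | @tail y z _ h ih =>
    refine ih.trans ?_
    rcases h.mul_simpleRefl hi with rfl | h'
    · rw [lower_mul_simpleRefl]
    · have h1 : BruhatLE (lower hi y) z := (lower_bruhatLE hi y).trans (.single h)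
      have h2 : BruhatLE (lower hi y) (z * simpleRefl i hi) := by
        rw [← lower_mul_simpleRefl]
        exact (lower_bruhatLE hi _).trans (.single h')
      conv_rhs => unfold lower
      split_ifs <;> assumption

/-- A form of the lifting property of the Bruhat order. -/
lemma bruhatLE_of_bruhatLE_mul_simpleRefl {a b : Perm (Fin n)}
    (ha : len (a * simpleRefl i hi) < len a) (h : BruhatLE a b ∨ BruhatLE a (b * simpleRefl i hi)) :
    BruhatLE (a * simpleRefl i hi) b := by
  have hl : lower hi a = a * simpleRefl i hi := if_pos ha
  rw [← hl]
  refine Relation.ReflTransGen.trans ?_ (lower_bruhatLE hi b)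
  rcases h with h | h
  · exact bruhatLE_lower hi h
  · rw [← lower_mul_simpleRefl hi b]
    exact bruhatLE_lower hi h

end SimpleReflections

/-! ### The long element -/

lemma longElt_apply {n : ℕ} (k : Fin n) : longElt n k = k.rev := rfl

lemma longElt_inv (n : ℕ) : (longElt n)⁻¹ = longElt n := rfl

lemma longElt_mul_self (n : ℕ) : longElt n * longElt n = 1 := by
  ext k; simp [longElt_apply]

lemma eq_of_forall_lt {n : ℕ} (w : Perm (Fin n))
    (h : ∀ (i : ℕ) (hi : i + 1 < n), w ⟨i, Nat.lt_of_succ_lt hi⟩ < w ⟨i + 1, hi⟩) : w = 1 := by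
  have hm : StrictMono w := by
    cases n with
    | zero => exact fun a => a.elim0
    | succ m => exact Fin.strictMono_iff_lt_succ.2 fun i => h i (by omega)
  ext k
  have := Subsingleton.elim (hm.orderIsoOfSurjective w w.surjective) (OrderIso.refl _)
  have := congrArg (fun f => (f k : ℕ)) this
  simpa using this

/-- Descending induction from the long element along right multiplication by simple
reflections. -/
lemma longElt_induction {n : ℕ} {P : Perm (Fin n) → Prop} (base : P (longElt n))
    (step : ∀ (w : Perm (Fin n)) (i : ℕ) (hi : i + 1 < n), len (w * simpleRefl i hi) < len w →
      P w → P (w * simpleRefl i hi)) (w : Perm (Fin n)) : P w := by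
  -- Any upper bound for the length serves here; the number of all pairs is the cheapest one.
  obtain ⟨k, hk⟩ : ∃ k, k = Fintype.card (Fin n × Fin n) - len w := ⟨_, rfl⟩
  induction k using Nat.strong_induction_on generalizing w with
  | _ k ih =>
    by_cases hw : ∀ (i : ℕ) (hi : i + 1 < n), w ⟨i + 1, hi⟩ < w ⟨i, Nat.lt_of_succ_lt hi⟩
    -- Without ascents, `w` is decreasing, so `w₀ w` is increasing and must be the identity.
    · have : longElt n * w = 1 := eq_of_forall_lt _ fun i hi => by
        simpa [longElt_apply] using hw i hi
      have : w = longElt n := by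
        rw [← one_mul w, ← longElt_mul_self, mul_assoc, this, mul_one]
      rwa [this]
    · push Not at hw
      obtain ⟨i, hi, h⟩ := hw
      have h' : w ⟨i, Nat.lt_of_succ_lt hi⟩ < w ⟨i + 1, hi⟩ :=
        lt_of_le_of_ne h (w.injective.ne (by simp [Fin.ext_iff]))
      have hl := len_mul_simpleRefl_of_lt hi w h'
      have hle : len (w * simpleRefl i hi) ≤ Fintype.card (Fin n × Fin n) := Finset.card_le_univ _
      have := step (w * simpleRefl i hi) i hi (by rw [mul_simpleRefl_mul_simpleRefl]; omega)
        (ih _ (by omega) _ rfl)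
      rwa [mul_simpleRefl_mul_simpleRefl] at this

/-- All pairs `p < q` are inversions of the long element. Reversing the positions matches the
inversions of `u w₀` with the pairs that are not inversions of `u`. -/
lemma len_longElt {n : ℕ} (u : Perm (Fin n)) : len (longElt n) = len u + len (u * longElt n) := by
  classical
  have h1 : inversions (longElt n) = Finset.univ.filter fun p : Fin n × Fin n => p.1 < p.2 := by
    ext p
    simp [mem_inversions, longElt_apply]
  have h2 : len (u * longElt n) =
      ((inversions (longElt n)).filter fun p => ¬ u p.2 < u p.1).card := by
    refine Finset.card_nbij' (fun p => (p.2.rev, p.1.rev)) (fun p => (p.2.rev, p.1.rev)) ?_ ?_ ?_ ?_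
    · rintro ⟨p, q⟩ hp
      have hp := mem_inversions.1 hp
      simp only [Finset.coe_filter, Set.mem_ofPred_eq, h1, Finset.mem_filter, Finset.mem_univ,
        true_and, Fin.rev_lt_rev, not_lt]
      exact ⟨hp.1, hp.2.le⟩
    · rintro ⟨p, q⟩ hp
      simp only [Finset.coe_filter, Set.mem_ofPred_eq, h1, Finset.mem_filter, Finset.mem_univ,
        true_and, not_lt] at hp
      refine mem_inversions.2 ⟨by simpa using hp.1, ?_⟩
      simp only [Perm.mul_apply, longElt_apply, Fin.rev_rev]
      exact lt_of_le_of_ne hp.2 (u.injective.ne hp.1.ne)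
    · rintro ⟨p, q⟩ _; simp
    · rintro ⟨p, q⟩ _; simp
  have h3 : inversions u = (inversions (longElt n)).filter fun p => u p.2 < u p.1 := by
    ext p
    simp [mem_inversions, h1]
  rw [h2, len_eq u, h3, len_eq]
  exact (Finset.card_filter_add_card_filter_not _).symm

/-! ### Signs of antisymmetric products -/

lemma prod_filter_lt {n : ℕ} {M : Type*} [CommMonoid M] (f : Fin n → Fin n → M) :
    ∏ p ∈ Finset.univ.filter (fun p : Fin n × Fin n => p.1 < p.2), f p.1 p.2 =
      ∏ i, ∏ j ∈ Finset.Ioi i, f i j := by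
  rw [Finset.prod_filter, Fintype.prod_prod_type]
  refine Finset.prod_congr rfl fun i _ => ?_
  rw [← Finset.prod_filter]
  refine Finset.prod_congr ?_ fun _ _ => rfl
  ext; simp

lemma sign_eq_neg_one_pow_len {n : ℕ} (u : Perm (Fin n)) : Perm.sign u = (-1) ^ len u := by
  rw [Equiv.Perm.sign_eq_prod_prod_Ioi,
    ← prod_filter_lt (fun i j => if u i < u j then (1 : ℤˣ) else -1), Finset.prod_ite,
    Finset.prod_const_one, one_mul, Finset.prod_const, len_eq, Finset.filter_filter]
  congr 2
  ext p
  simp only [Finset.mem_filter, Finset.mem_univ, true_and, mem_inversions, not_lt]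
  exact and_congr_right fun h => ⟨fun h' => lt_of_le_of_ne h' (u.injective.ne h.ne'), le_of_lt⟩

lemma prod_filter_lt_comp {n : ℕ} {R : Type*} [CommRing R] (u : Perm (Fin n))
    {f : Fin n → Fin n → R} (hf : ∀ i j, f i j = -f j i) :
    ∏ p ∈ Finset.univ.filter (fun p : Fin n × Fin n => p.1 < p.2), f (u p.1) (u p.2) =
      (-1) ^ len u * ∏ p ∈ Finset.univ.filter (fun p : Fin n × Fin n => p.1 < p.2), f p.1 p.2 := by
  rw [prod_filter_lt (fun i j => f (u i) (u j)), prod_filter_lt,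
    u.prod_Ioi_comp_eq_sign_mul_prod hf, sign_eq_neg_one_pow_len]
  simp

/-! ### Sums over paths -/

/-- The sum over all paths `a = p 0, p 1, …, p m = b` of the products of the weights
`f i (p i) (p (i + 1))`. -/
def pathSum {A R : Type*} [Fintype A] [DecidableEq A] [CommRing R] :
    (m : ℕ) → (Fin m → A → A → R) → A → A → R
  | 0, _, a, b => if a = b then 1 else 0
  | m + 1, f, a, b => ∑ c, f 0 a c * pathSum m (fun i => f i.succ) c b

section PathSum

variable {A R : Type*} [Fintype A] [DecidableEq A] [CommRing R]

lemma pathSum_zero (f : Fin 0 → A → A → R) (a b : A) :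
    pathSum 0 f a b = if a = b then 1 else 0 := rfl

lemma pathSum_succ {m : ℕ} (f : Fin (m + 1) → A → A → R) (a b : A) :
    pathSum (m + 1) f a b = ∑ c, f 0 a c * pathSum m (fun i => f i.succ) c b := rfl

lemma sum_paths_eq_pathSum (m : ℕ) (f : Fin m → A → A → R) (a b : A) :
    (∑ p : Fin (m + 1) → A, if p 0 = a ∧ p (Fin.last m) = b then
      ∏ i, f i (p i.castSucc) (p i.succ) else 0) = pathSum m f a b := by
  induction m generalizing a with
  | zero =>
    rw [← (Equiv.funUnique (Fin 1) A).symm.sum_comp, pathSum_zero, Finset.sum_eq_single a]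
    · simp
    · intro c _ hc
      simp [hc]
    · simp
  | succ m ih =>
    rw [← (Fin.consEquiv fun _ => A).sum_comp, Fintype.sum_prod_type, Finset.sum_eq_single a]
    · rw [pathSum_succ]
      simp_rw [← ih, Finset.mul_sum]
      rw [Finset.sum_comm]
      refine Finset.sum_congr rfl fun p _ => ?_
      rw [Finset.sum_eq_single (p 0)]
      · simp only [Fin.consEquiv_apply, Fin.cons_zero, Fin.prod_univ_succ, true_and,
          Fin.castSucc_zero, Fin.cons_succ, mul_ite, mul_zero, Fin.castSucc_succ]
        rw [← Fin.succ_last, Fin.cons_succ]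
      · intro c _ hc
        simp [hc.symm]
      · simp
    · intro c _ hc
      simp [hc]
    · simp

/-- A linear relation between two consecutive steps of paths extends to whole paths. -/
lemma pathSum_exchange (Good : A → Prop) {m : ℕ} {i : ℕ} (hi : i + 1 < m)
    (f₁ f₂ f₃ : Fin m → A → A → R) (k₁ k₂ k₃ : R)
    (h₂ : ∀ j : Fin m, (j : ℕ) ≠ i → (j : ℕ) ≠ i + 1 → f₂ j = f₁ j)
    (h₃ : ∀ j : Fin m, (j : ℕ) ≠ i → (j : ℕ) ≠ i + 1 → f₃ j = f₁ j)
    (hgood : ∀ j s c, Good s → f₁ j s c ≠ 0 → Good c)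
    (hex : ∀ s e, Good s →
      k₁ * ∑ c, f₁ ⟨i, Nat.lt_of_succ_lt hi⟩ s c * f₁ ⟨i + 1, hi⟩ c e =
        k₂ * ∑ c, f₂ ⟨i, Nat.lt_of_succ_lt hi⟩ s c * f₂ ⟨i + 1, hi⟩ c e +
        k₃ * ∑ c, f₃ ⟨i, Nat.lt_of_succ_lt hi⟩ s c * f₃ ⟨i + 1, hi⟩ c e)
    {s : A} (hs : Good s) (e : A) :
    k₁ * pathSum m f₁ s e = k₂ * pathSum m f₂ s e + k₃ * pathSum m f₃ s e := by
  induction i generalizing m s with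
  | zero =>
    -- The two modified steps are now the first two. Grouping the paths by the state after them
    -- leaves a tail common to all three path sums.
    obtain ⟨m, rfl⟩ : ∃ k, m = k + 2 := ⟨m - 2, by omega⟩
    have key : ∀ f : Fin (m + 2) → A → A → R, pathSum (m + 2) f s e =
        ∑ d, (∑ c, f 0 s c * f 1 c d) * pathSum m (fun i => f i.succ.succ) d e := by
      intro f
      rw [pathSum_succ]
      simp_rw [pathSum_succ, Finset.mul_sum, Finset.sum_mul]
      rw [Finset.sum_comm]
      simp [mul_assoc]
    have e₂ : (fun i : Fin m => f₂ i.succ.succ) = fun i => f₁ i.succ.succ :=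
      funext fun j => h₂ _ (by simp) (by simp)
    have e₃ : (fun i : Fin m => f₃ i.succ.succ) = fun i => f₁ i.succ.succ :=
      funext fun j => h₃ _ (by simp) (by simp)
    rw [key, key, key, e₂, e₃, Finset.mul_sum, Finset.mul_sum, Finset.mul_sum,
      ← Finset.sum_add_distrib]
    refine Finset.sum_congr rfl fun d _ => ?_
    rw [← mul_assoc, ← mul_assoc, ← mul_assoc, ← add_mul]
    congr 1
    exact hex s d hs
  | succ i ih =>
    obtain ⟨m, rfl⟩ : ∃ k, m = k + 1 := ⟨m - 1, by omega⟩
    rw [pathSum_succ, pathSum_succ, pathSum_succ, h₂ 0 (by simp) (by simp),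
      h₃ 0 (by simp) (by simp), Finset.mul_sum, Finset.mul_sum, Finset.mul_sum,
      ← Finset.sum_add_distrib]
    refine Finset.sum_congr rfl fun c _ => ?_
    -- The invariant `Good` has to reach the modified steps only along transitions of nonzero
    -- weight.
    by_cases hc : f₁ 0 s c = 0
    · simp [hc]
    have := ih (m := m) (by omega) (fun j => f₁ j.succ) (fun j => f₂ j.succ) (fun j => f₃ j.succ)
      (fun j hj hj' => h₂ _ (by simpa using hj) (by simpa using hj'))
      (fun j hj hj' => h₃ _ (by simpa using hj) (by simpa using hj'))
      (fun j => hgood j.succ) (fun s e hs => hex s e hs) (hgood 0 s c hs hc)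
    linear_combination f₁ 0 s c * this

end PathSum

/-! ### The partition function as a sum over paths -/

/-- The Boltzmann weight, as a function of the ratio `z` of the parameters. -/
def vertexWeight {n : ℕ} {R : Type*} [CommRing R] (t z : R)
    (left : Option (Fin n)) (top : Finset (Fin n))
    (right : Option (Fin n)) (bottom : Finset (Fin n)) : R :=
  match left, right with
  | none, none => if bottom = top then (-t) ^ top.card else 0
  | none, some c =>
      if c ∈ top ∧ bottom = top.erase c then
        (-t) ^ (top.filter (· < c)).card * t ^ (top.filter (c < ·)).card
      else 0
  | some c, none =>
      if c ∉ top ∧ bottom = insert c top then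
        (t - 1) * z * (-t) ^ (top.filter (c < ·)).card
      else 0
  | some c, some d =>
      if c = d then
        if bottom = top then
          t ^ (top.filter (c < ·)).card * ((if c ∈ top then t else 1) - z)
        else 0
      else if c ∉ top ∧ d ∈ top ∧ bottom = insert c (top.erase d) then
        if c < d then
          (t - 1) * z * (-t) ^ (top.filter fun e => c < e ∧ e < d).card
            * t ^ (top.filter (d < ·)).card
        else
          (t - 1) * (-1) ^ (top.filter fun e => d < e ∧ e < c).card
            * t ^ (top.filter (c < ·)).card
      else 0

lemma boltzmann_eq_vertexWeight {n : ℕ} {R : Type*} [CommRing R] (t : R) (x y : Rˣ)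
    (left : Option (Fin n)) (top : Finset (Fin n)) (right : Option (Fin n))
    (bottom : Finset (Fin n)) :
    boltzmann t x y left top right bottom =
      vertexWeight t ((x * y⁻¹ : Rˣ) : R) left top right bottom := rfl

lemma map_vertexWeight {n : ℕ} {R S : Type*} [CommRing R] [CommRing S] (φ : R →+* S) (t z : R)
    (left : Option (Fin n)) (top : Finset (Fin n)) (right : Option (Fin n))
    (bottom : Finset (Fin n)) :
    φ (vertexWeight t z left top right bottom) =
      vertexWeight (φ t) (φ z) left top right bottom := by
  cases left <;> cases right <;> simp only [vertexWeight] <;> split_ifs <;> simp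

lemma map_partitionFn {n : ℕ} {R S : Type*} [CommRing R] [CommRing S] (φ : R →+* S) (t : R)
    (x y : Fin n → Rˣ) (σ w : Perm (Fin n)) :
    φ (partitionFn t x y σ w) = partitionFn (φ t) (fun i => Units.map (φ : R →* S) (x i))
      (fun j => Units.map (φ : R →* S) (y j)) σ w := by
  simp only [partitionFn, map_sum, map_prod, boltzmann_eq_vertexWeight, map_vertexWeight]
  simp only [← map_inv, ← map_mul, Units.coe_map, MonoidHom.coe_coe]

/-- The weight of a row with right boundary edge `a` and uncolored left boundary edge, summed over
the decorations of its inner edges. The ratio of the parameters in column `j` is `z j`. -/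
def rowWeight {n K : ℕ} {R : Type*} [CommRing R] (t : R) (z : Fin K → R) (a : Option (Fin n))
    (top bottom : Fin K → Finset (Fin n)) : R :=
  pathSum K (fun j r l => vertexWeight t (z j) l (top j) r (bottom j)) a none

lemma rowWeight_zero {n : ℕ} {R : Type*} [CommRing R] (t : R) (z : Fin 0 → R) (a : Option (Fin n))
    (top bottom : Fin 0 → Finset (Fin n)) :
    rowWeight t z a top bottom = if a = none then 1 else 0 := rfl

lemma rowWeight_succ {n K : ℕ} {R : Type*} [CommRing R] (t : R) (z : Fin (K + 1) → R)
    (a : Option (Fin n)) (top bottom : Fin (K + 1) → Finset (Fin n)) :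
    rowWeight t z a top bottom = ∑ c, vertexWeight t (z 0) c (top 0) a (bottom 0) *
      rowWeight t (fun j => z j.succ) c (fun j => top j.succ) (fun j => bottom j.succ) := rfl

/-- The row transfer matrix: the states are the decorations of a full row of vertical edges. For
fixed vertical edges the rows are independent, so the sum over the horizontal edges is a product of
row weights. -/
lemma partitionFn_eq_pathSum {n : ℕ} {R : Type*} [CommRing R] (t : R) (x y : Fin n → Rˣ)
    (σ w : Perm (Fin n)) :
    partitionFn t x y σ w = pathSum n
      (fun i => rowWeight t (fun j => ((x i * (y j)⁻¹ : Rˣ) : R)) (some (w i)))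
      (fun j => {σ j}) (fun _ => ∅) := by
  classical
  rw [← sum_paths_eq_pathSum]
  simp_rw [rowWeight, ← sum_paths_eq_pathSum]
  rw [partitionFn, Finset.sum_filter, Fintype.sum_prod_type, Finset.sum_comm]
  refine Finset.sum_congr rfl fun V _ => ?_
  simp_rw [Finset.prod_univ_sum, Fintype.piFinset_univ]
  by_cases hV : V 0 = (fun j => {σ j}) ∧ V (Fin.last n) = fun _ => ∅
  · rw [if_pos hV]
    refine Finset.sum_congr rfl fun H _ => ?_
    by_cases hH : ∀ i, H i 0 = some (w i) ∧ H i (Fin.last n) = none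
    · rw [if_pos]
      · refine Finset.prod_congr rfl fun i _ => ?_
        rw [if_pos (hH i)]
        rfl
      · exact ⟨fun j => congrFun hV.1 j, fun j => congrFun hV.2 j, fun i => (hH i).1,
          fun i => (hH i).2⟩
    · rw [if_neg fun h => hH fun i => ⟨h.2.2.1 i, h.2.2.2 i⟩]
      push Not at hH
      obtain ⟨i, hi⟩ := hH
      exact (Finset.prod_eq_zero (Finset.mem_univ i) (if_neg fun h => hi h.1 h.2)).symm
  · rw [if_neg hV]
    refine Finset.sum_eq_zero fun H _ => if_neg fun h => hV ⟨funext h.1, funext h.2.1⟩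

/-! ### The factorized form of the vertex weights -/

section Factorized

variable {n : ℕ} {F : Type*} [Field F]

/-- The factor that a color `e` passing vertically contributes for the left edge of a vertex. -/
def leftFactor (t : F) (e : Fin n) : Option (Fin n) → F
  | none => -t
  | some c => if c < e then -t else 1

/-- The factor that a color `e` passing vertically contributes for the right edge of a vertex. -/
def rightFactor (e : Fin n) : Option (Fin n) → F
  | none => 1
  | some c => if c < e then -1 else 1

/-- The part of the vertex weight that does not depend on the colors passing vertically. -/
def coreWeight (t z : F) : Option (Fin n) → Option (Fin n) → F
  | none, none => 1
  | none, some _ => -1 / t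
  | some _, none => (t - 1) * z
  | some c, some d => if c = d then 1 - z else if c < d then (1 - t) * z / t else t - 1

/-- `leftFactor` for an optional color. -/
def leftFactor' (t : F) : Option (Fin n) → Option (Fin n) → F
  | none, _ => 1
  | some e, l => leftFactor t e l

/-- `rightFactor` for an optional color. -/
def rightFactor' : Option (Fin n) → Option (Fin n) → F
  | none, _ => 1
  | some e, r => rightFactor e r

lemma prod_leftFactor_none (t : F) (T : Finset (Fin n)) :
    ∏ e ∈ T, leftFactor t e none = (-t) ^ T.card := by
  simp [leftFactor]

lemma prod_leftFactor_some (t : F) (T : Finset (Fin n)) (c : Fin n) :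
    ∏ e ∈ T, leftFactor t e (some c) = (-t) ^ (T.filter (c < ·)).card := by
  simp [leftFactor, Finset.prod_ite]

lemma prod_rightFactor_none (T : Finset (Fin n)) :
    ∏ e ∈ T, rightFactor e none = (1 : F) := by
  simp [rightFactor]

lemma prod_rightFactor_some (T : Finset (Fin n)) (c : Fin n) :
    ∏ e ∈ T, rightFactor e (some c) = ((-1) ^ (T.filter (c < ·)).card : F) := by
  simp [rightFactor, Finset.prod_ite]

lemma card_eq_card_lt_add_card_gt {T : Finset (Fin n)} {c : Fin n} (hc : c ∈ T) :
    T.card = (T.filter (· < c)).card + 1 + (T.filter (c < ·)).card := by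
  have h1 := Finset.card_filter_add_card_filter_not (s := T) (· < c)
  have h2 : T.filter (fun e => ¬ e < c) = insert c (T.filter (c < ·)) := by
    ext e
    simp only [Finset.mem_filter, Finset.mem_insert, not_lt, le_iff_eq_or_lt]
    constructor
    · rintro ⟨he, rfl | h⟩
      · exact .inl rfl
      · exact .inr ⟨he, h⟩
    · rintro (rfl | h)
      · exact ⟨hc, .inl rfl⟩
      · exact ⟨h.1, .inr h.2⟩
  rw [h2, Finset.card_insert_of_notMem (by simp)] at h1
  omega

lemma card_gt_eq_card_between_add {T : Finset (Fin n)} {c d : Fin n} (hcd : c < d) :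
    (T.filter (c < ·)).card = (T.filter fun e => c < e ∧ e < d).card +
      (if d ∈ T then 1 else 0) + (T.filter (d < ·)).card := by
  have h1 := Finset.card_filter_add_card_filter_not (s := T.filter (c < ·)) (· < d)
  have h2 : (T.filter (c < ·)).filter (fun e => ¬ e < d) =
      (T.filter (d < ·)) ∪ (if d ∈ T then {d} else ∅) := by
    ext e
    have : e ∈ (if d ∈ T then {d} else ∅ : Finset (Fin n)) ↔ e = d ∧ d ∈ T := by
      split_ifs with h <;> simp [h]
    simp only [Finset.mem_filter, Finset.mem_union, not_lt, this]
    constructor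
    · rintro ⟨⟨h1, h2⟩, h3⟩
      rcases h3.eq_or_lt with rfl | h
      · exact .inr ⟨rfl, h1⟩
      · exact .inl ⟨h1, h⟩
    · rintro (⟨h1, h2⟩ | ⟨rfl, h2⟩)
      · exact ⟨⟨h1, hcd.trans h2⟩, h2.le⟩
      · exact ⟨⟨h2, hcd⟩, le_rfl⟩
  rw [h2, Finset.filter_filter, Finset.card_union_of_disjoint] at h1
  · rw [← h1]
    split_ifs
    · simp; ring
    · simp
  · split_ifs <;> simp

/-- The condition that the color of the right edge comes from above or from the left. -/
def Admissible (l : Option (Fin n)) (T : Finset (Fin n)) (r : Option (Fin n)) : Prop :=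
  ∀ c, r = some c → c ∈ T ∨ l = some c

open Classical in
-- The products run over all of `T`, including the color of the right edge when it comes from above;
-- the denominators `t` in `coreWeight` remove that superfluous factor. The hypothesis `hl` excludes
-- the vertex with factor `t - z`, where the same color enters from the left and from above and
-- which does not factor in this way.
lemma vertexWeight_eq {t : F} (ht : t ≠ 0) (z : F) (l : Option (Fin n)) (T : Finset (Fin n))
    (r : Option (Fin n)) (B : Finset (Fin n)) (hl : ∀ c, l = some c → c ∉ T) :
    vertexWeight t z l T r B =
      if Admissible l T r ∧ B = (T ∪ l.toFinset) \ r.toFinset then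
        (∏ e ∈ T, leftFactor t e l) * (∏ e ∈ T, rightFactor e r) * coreWeight t z l r
      else 0 := by
  have hsq : ∀ k : ℕ, ((-1 : F) ^ k) * (-1) ^ k = 1 := fun k => by
    rw [← mul_pow]; simp
  have hn : ∀ k : ℕ, (-t) ^ k = (-1) ^ k * t ^ k := fun k => neg_pow t k
  rcases l with _ | c <;> rcases r with _ | d
  · simp [vertexWeight, Admissible, coreWeight, prod_leftFactor_none, prod_rightFactor_none]
  · simp only [vertexWeight, Admissible, Option.some.injEq, reduceCtorEq, or_false, forall_eq',
      Option.toFinset_none, Finset.union_empty, Option.toFinset_some,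
      Finset.sdiff_singleton_eq_erase]
    split_ifs with h
    · rw [prod_leftFactor_none, prod_rightFactor_some, coreWeight,
        card_eq_card_lt_add_card_gt h.1]
      simp only [hn, pow_add, pow_one]
      field_simp
      linear_combination -hsq (T.filter (d < ·)).card
    · rfl
  · have hc := hl c rfl
    have e : T ∪ {c} = insert c T := by rw [Finset.union_comm]; rfl
    simp only [vertexWeight, Admissible, reduceCtorEq, false_imp_iff, implies_true, true_and,
      Option.toFinset_none, Finset.sdiff_empty, Option.toFinset_some, hc, not_false_eq_true, e,
      prod_leftFactor_some, prod_rightFactor_none, coreWeight]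
    split_ifs
    · ring
    · rfl
  · have hc := hl c rfl
    have e : (T ∪ {c}) \ {d} = (insert c T).erase d := by
      rw [Finset.union_comm, Finset.sdiff_singleton_eq_erase]; rfl
    simp only [vertexWeight, Admissible, Option.some.injEq, forall_eq', Option.toFinset_some,
      e, prod_leftFactor_some, prod_rightFactor_some, coreWeight, hc, not_false_eq_true, true_and]
    by_cases hcd : c = d
    · subst hcd
      simp only [if_true, or_true, true_and, Finset.erase_insert hc, if_false]
      split_ifs
      · rw [hn]
        linear_combination (-t ^ (T.filter (c < ·)).card * (1 - z)) * hsq (T.filter (c < ·)).card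
      · rfl
    · have hne : (insert c T).erase d = insert c (T.erase d) := Finset.erase_insert_of_ne hcd
      simp only [or_false, hne, hcd, if_false]
      split_ifs with h1 h2
      · have := card_gt_eq_card_between_add (T := T) h2
        rw [if_pos h1.1] at this
        rw [this]
        simp only [hn, pow_add, pow_one]
        field_simp
        linear_combination (-(t - 1) * z) * hsq (T.filter (d < ·)).card
      · have := card_gt_eq_card_between_add (T := T) (lt_of_le_of_ne (not_lt.1 h2) (Ne.symm hcd))
        rw [if_neg hc, add_zero] at this
        rw [this]
        simp only [hn, pow_add]
        linear_combination (-(t - 1) * (-1) ^ (T.filter fun e => d < e ∧ e < c).card *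
          t ^ (T.filter (c < ·)).card : F) * hsq (T.filter (c < ·)).card
      · rfl

/-- Below a vertex the left color has joined `T` and the right color has left it. Stated as a
product on both sides so that it holds without division. -/
lemma prod_replace {M : Type*} [CommMonoid M] (f : Fin n → M) {l : Option (Fin n)}
    {T : Finset (Fin n)} {r : Option (Fin n)} (hl : ∀ c, l = some c → c ∉ T)
    (h : Admissible l T r) :
    (∏ e ∈ (T ∪ l.toFinset) \ r.toFinset, f e) * r.elim 1 f = (∏ e ∈ T, f e) * l.elim 1 f := by
  have h1 : r.elim 1 f = ∏ e ∈ r.toFinset, f e := by cases r <;> simp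
  have h2 : l.elim 1 f = ∏ e ∈ l.toFinset, f e := by cases l <;> simp
  rw [h1, h2, Finset.prod_sdiff, Finset.prod_union]
  · rw [Finset.disjoint_right]
    intro e he
    exact hl e (Option.mem_toFinset.1 he)
  · intro e he
    rw [Finset.mem_union, Option.mem_toFinset]
    exact h e (Option.mem_toFinset.1 he)

/-- The core weight of two vertices above each other, with left edges `c`, `d` and right edges
`a`, `b` from top to bottom. -/
def coreWeight₂ (t z₁ z₂ : F) (c d a b : Option (Fin n)) : F :=
  if a = d ∧ a ≠ none then 0
  else coreWeight t z₁ c a * coreWeight t z₂ d b *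
    (leftFactor' t c d * rightFactor' c b / (leftFactor' t a d * rightFactor' a b))

/-- The weight of two vertices above each other. -/
def vertexWeight₂ (t z₁ z₂ : F) (c d a b : Option (Fin n)) (T B : Finset (Fin n)) : F :=
  ∑ M, vertexWeight t z₁ c T a M * vertexWeight t z₂ d M b B

/-- Conservation of colors at two vertices above each other. -/
def Balanced (c d a b : Option (Fin n)) (T B : Finset (Fin n)) : Prop :=
  (∀ e, a = some e ∨ b = some e → e ∈ T ∨ c = some e ∨ d = some e) ∧
    (∀ e, a = some e → b ≠ some e) ∧
    B = (T ∪ (c.toFinset ∪ d.toFinset)) \ (a.toFinset ∪ b.toFinset)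

/-- The contribution of the colors passing vertically through two vertices above each other. -/
def passing (t : F) (c d a b : Option (Fin n)) (T : Finset (Fin n)) : F :=
  ((∏ e ∈ T, leftFactor t e c) * ∏ e ∈ T, leftFactor t e d) *
    ((∏ e ∈ T, rightFactor e a) * ∏ e ∈ T, rightFactor e b)

lemma leftFactor_ne_zero {t : F} (ht : t ≠ 0) (e : Fin n) (l : Option (Fin n)) :
    leftFactor t e l ≠ 0 := by
  cases l <;> simp only [leftFactor] <;> (try split_ifs) <;> simp [ht]

lemma rightFactor_ne_zero (e : Fin n) (l : Option (Fin n)) : rightFactor e l ≠ (0 : F) := by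
  cases l <;> simp only [rightFactor] <;> (try split_ifs) <;> simp

open Classical in
-- Conservation of colors forces the middle set to be `N`. The quotient in `coreWeight₂` corrects
-- the products over `N`, which the lower vertex requires, to products over `T`. After this
-- `Balanced` and `passing` are symmetric in `c`, `d` and in `a`, `b`, hence common to all terms of
-- an exchange relation.
lemma vertexWeight₂_eq {t : F} (ht : t ≠ 0) (z₁ z₂ : F) (c d a b : Option (Fin n))
    (T B : Finset (Fin n)) (hc : ∀ e, c = some e → e ∉ T) (hd : ∀ e, d = some e → e ∉ T)
    (hcd : ∀ e, c = some e → d ≠ some e) :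
    vertexWeight₂ t z₁ z₂ c d a b T B =
      if Balanced c d a b T B then passing t c d a b T * coreWeight₂ t z₁ z₂ c d a b else 0 := by
  set N := (T ∪ c.toFinset) \ a.toFinset with hN
  have hdN : ∀ e, d = some e → e ∉ N := by
    intro e he
    simp only [hN, Finset.mem_sdiff, Finset.mem_union, Option.mem_toFinset, not_and_or, not_or]
    exact .inl ⟨hd e he, fun h => hcd e h he⟩
  rw [vertexWeight₂, Finset.sum_eq_single N]
  rotate_left
  · intro M _ hM
    rw [vertexWeight_eq ht z₁ c T a M hc, if_neg fun h => hM h.2, zero_mul]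
  · simp
  rw [vertexWeight_eq ht z₁ c T a N hc, vertexWeight_eq ht z₂ d N b B hdN]
  -- A color entering at the lower left cannot leave at the upper right.
  by_cases had : a = d ∧ a ≠ none
  · rw [if_neg, zero_mul, coreWeight₂, if_pos had, mul_zero, ite_self]
    rintro ⟨h, -⟩
    obtain ⟨e, he⟩ := Option.ne_none_iff_exists'.1 had.2
    rcases h e he with h | h
    · exact hd e (had.1 ▸ he) h
    · exact hcd e h (had.1 ▸ he)
  have hB : (N ∪ d.toFinset) \ b.toFinset =
      (T ∪ (c.toFinset ∪ d.toFinset)) \ (a.toFinset ∪ b.toFinset) := by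
    ext e
    simp only [hN, Finset.mem_sdiff, Finset.mem_union, Option.mem_toFinset, Option.mem_def]
    have h1 : a = some e → d ≠ some e := fun h h' => had ⟨h.trans h'.symm, by simp [h]⟩
    tauto
  by_cases hbal : Balanced c d a b T B
  · obtain ⟨h1, h2, h3⟩ := hbal
    have hadm₁ : Admissible c T a := by
      intro e he
      rcases h1 e (.inl he) with h | h | h
      · exact .inl h
      · exact .inr h
      · exact absurd ⟨he.trans h.symm, by simp [he]⟩ had
    have hadm₂ : Admissible d N b := by
      intro e he
      have hae : a ≠ some e := fun h => h2 e h he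
      simp only [hN, Finset.mem_sdiff, Finset.mem_union, Option.mem_toFinset, Option.mem_def]
      rcases h1 e (.inr he) with h | h | h
      · exact .inl ⟨.inl h, hae⟩
      · exact .inl ⟨.inr h, hae⟩
      · exact .inr h
    rw [if_pos ⟨hadm₁, rfl⟩, if_pos ⟨hadm₂, by rw [hB, h3]⟩, if_pos ⟨h1, h2, h3⟩, coreWeight₂,
      if_neg had, passing]
    have hl := prod_replace (fun e => leftFactor t e d) hc hadm₁
    have hr := prod_replace (fun e => (rightFactor e b : F)) hc hadm₁
    have el : ∀ o : Option (Fin n), o.elim 1 (fun e => leftFactor t e d) = leftFactor' t o d := by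
      intro o; cases o <;> rfl
    have er : ∀ o : Option (Fin n), o.elim 1 (fun e => (rightFactor e b : F)) =
        rightFactor' o b := by
      intro o; cases o <;> rfl
    rw [el, el] at hl
    rw [er, er] at hr
    have hl0 : leftFactor' t a d ≠ 0 := by
      cases a
      · exact one_ne_zero
      · exact leftFactor_ne_zero ht _ _
    have hr0 : rightFactor' a b ≠ (0 : F) := by
      cases a
      · exact one_ne_zero
      · exact rightFactor_ne_zero _ _
    rw [← eq_div_iff hl0] at hl
    rw [← eq_div_iff hr0] at hr
    rw [hl, hr]
    field_simp
  · rw [if_neg hbal]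
    by_cases hadm₁ : Admissible c T a
    · rw [if_neg (c := Admissible d N b ∧ _), mul_zero]
      rintro ⟨h1, h2⟩
      refine hbal ⟨?_, ?_, by rw [h2, hB]⟩
      · rintro e (he | he)
        · exact (hadm₁ e he).imp id .inl
        · rcases h1 e he with h | h
          · simp only [hN, Finset.mem_sdiff, Finset.mem_union, Option.mem_toFinset,
              Option.mem_def] at h
            exact h.1.imp id .inl
          · exact .inr (.inr h)
      · intro e he he'
        rcases h1 e he' with h | h
        · simp [hN, he] at h
        · exact had ⟨he.trans h.symm, by simp [he]⟩
    · rw [if_neg fun h => hadm₁ h.1, zero_mul]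

/-- The order on edge decorations, in which the uncolored edge is the smallest. -/
def Below : Option (Fin n) → Option (Fin n) → Prop
  | _, none => False
  | none, some _ => True
  | some b, some a => b < a

/-- The parameter in the exchange relation. -/
def exchangeParam (z₁ z₂ : F) : Option (Fin n) → F
  | none => z₁
  | some _ => z₂

/-- The exchange relations for a family of weights of two rows with parameters `z₁`, `z₂` (`X`)
respectively `z₂`, `z₁` (`Y`), indexed by the right edges. -/
def ExchangeRel (t z₁ z₂ : F) (X Y : Option (Fin n) → Option (Fin n) → F) : Prop :=
  ∀ b a, Below b a →
    (z₂ - z₁) * X b a = (t - 1) * exchangeParam z₁ z₂ b * X a b + (z₁ - t * z₂) * Y a b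

/-- Each alternative carries all the negations, so that the conditionals in the core weights can be
decided by rewriting. -/
lemma lt_trichotomy_facts (a b : Fin n) :
    (a < b ∧ ¬ b < a ∧ a ≠ b ∧ b ≠ a) ∨ a = b ∨ (b < a ∧ ¬ a < b ∧ a ≠ b ∧ b ≠ a) := by
  rcases lt_trichotomy a b with h | h | h
  · exact .inl ⟨h, h.not_gt, h.ne, h.ne'⟩
  · exact .inr (.inl h)
  · exact .inr (.inr ⟨h, h.not_gt, h.ne', h.ne⟩)

set_option maxHeartbeats 4000000 in
set_option linter.unusedSimpArgs false in
-- In the induction on columns, `X d c` and `Y d c` are eliminated by the relations for the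
-- remaining columns. The two identities here compare the coefficients of `X c d` and of `Y c d`,
-- the latter with a factor `z₁ - t * z₂` removed. They depend only on the relative order of the
-- four decorations.
lemma coreWeight₂_exchange {t k z₁ z₂ : F} (ht : t ≠ 0) {a b c d : Option (Fin n)}
    (hba : Below b a) (hdc : Below d c) :
    ((z₂ - z₁) ^ 2 * coreWeight₂ t (z₁ * k) (z₂ * k) c d b a +
      ((z₂ - z₁) * coreWeight₂ t (z₁ * k) (z₂ * k) d c b a -
        (t - 1) * exchangeParam z₁ z₂ b * coreWeight₂ t (z₁ * k) (z₂ * k) d c a b) *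
        ((t - 1) * exchangeParam z₁ z₂ d) =
      (z₂ - z₁) * (t - 1) * exchangeParam z₁ z₂ b * coreWeight₂ t (z₁ * k) (z₂ * k) c d a b -
      (z₁ - t * z₂) * (z₂ - t * z₁) * coreWeight₂ t (z₂ * k) (z₁ * k) d c a b) ∧
    ((z₂ - z₁) * coreWeight₂ t (z₁ * k) (z₂ * k) d c b a -
        (t - 1) * exchangeParam z₁ z₂ b * coreWeight₂ t (z₁ * k) (z₂ * k) d c a b =
      (z₂ - z₁) * coreWeight₂ t (z₂ * k) (z₁ * k) c d a b -
      (t - 1) * exchangeParam z₂ z₁ d * coreWeight₂ t (z₂ * k) (z₁ * k) d c a b) := by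
  rcases a with _ | a
  · exact absurd hba (by simp [Below])
  rcases c with _ | c
  · exact absurd hdc (by simp [Below])
  rcases b with _ | b <;> rcases d with _ | d
  · rcases lt_trichotomy_facts a c with ⟨_, _, _, _⟩ | h | ⟨_, _, _, _⟩ <;> (try subst h) <;>
      (simp only [coreWeight₂, coreWeight, leftFactor', rightFactor', leftFactor, rightFactor,
          exchangeParam, Option.some.injEq, reduceCtorEq, ne_eq, not_false_eq_true, and_true,
          false_and, not_true_eq_false, and_false, if_true, if_false, lt_irrefl, *];
        constructor <;> field_simp <;> ring)
  · have hdc' : d < c := hdc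
    have := hdc'.not_gt
    have := hdc'.ne
    have := hdc'.ne'
    rcases lt_trichotomy_facts a c with ⟨_, _, _, _⟩ | h | ⟨_, _, _, _⟩ <;>
      rcases lt_trichotomy_facts a d with ⟨_, _, _, _⟩ | h' | ⟨_, _, _, _⟩ <;>
      (try subst h) <;> (try subst h') <;>
      first
      | (exfalso; order)
      | simp only [coreWeight₂, coreWeight, leftFactor', rightFactor', leftFactor, rightFactor,
          exchangeParam, Option.some.injEq, reduceCtorEq, ne_eq, not_false_eq_true, and_true,
          false_and, not_true_eq_false, and_false, if_true, if_false, lt_irrefl, *]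
        constructor <;> field_simp <;> ring
  · have hba' : b < a := hba
    have := hba'.not_gt
    have := hba'.ne
    have := hba'.ne'
    rcases lt_trichotomy_facts a c with ⟨_, _, _, _⟩ | h | ⟨_, _, _, _⟩ <;>
      rcases lt_trichotomy_facts b c with ⟨_, _, _, _⟩ | h' | ⟨_, _, _, _⟩ <;>
      (try subst h) <;> (try subst h') <;>
      first
      | (exfalso; order)
      | simp only [coreWeight₂, coreWeight, leftFactor', rightFactor', leftFactor, rightFactor,
          exchangeParam, Option.some.injEq, reduceCtorEq, ne_eq, not_false_eq_true, and_true,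
          false_and, not_true_eq_false, and_false, if_true, if_false, lt_irrefl, *]
        constructor <;> field_simp <;> ring
  · have hba' : b < a := hba
    have := hba'.not_gt
    have := hba'.ne
    have := hba'.ne'
    have hdc' : d < c := hdc
    have := hdc'.not_gt
    have := hdc'.ne
    have := hdc'.ne'
    rcases lt_trichotomy_facts a c with ⟨_, _, _, _⟩ | h₁ | ⟨_, _, _, _⟩ <;>
      rcases lt_trichotomy_facts b d with ⟨_, _, _, _⟩ | h₂ | ⟨_, _, _, _⟩ <;>
      rcases lt_trichotomy_facts a d with ⟨_, _, _, _⟩ | h₃ | ⟨_, _, _, _⟩ <;>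
      (try (exfalso; order)) <;>
      rcases lt_trichotomy_facts b c with ⟨_, _, _, _⟩ | h₄ | ⟨_, _, _, _⟩ <;>
      (try (exfalso; order)) <;>
      (try subst h₁) <;> (try subst h₂) <;> (try subst h₃) <;> (try subst h₄) <;>
      (simp only [coreWeight₂, coreWeight, leftFactor', rightFactor', leftFactor, rightFactor,
          exchangeParam, Option.some.injEq, reduceCtorEq, ne_eq, not_false_eq_true, and_true,
          false_and, if_true, if_false, lt_irrefl, *];
        constructor <;> field_simp <;> ring)

end Factorized

/-! ### The exchange relations -/

section Exchange

variable {n : ℕ} {F : Type*} [Field F]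

/-- The diagonal term of the induction in which both left edges of the column are uncolored. -/
lemma coreWeight₂_exchange_left_none {t k z₁ z₂ : F} (ht : t ≠ 0) {a b : Option (Fin n)}
    (hba : Below b a) :
    (z₂ - z₁) * coreWeight₂ t (z₁ * k) (z₂ * k) none none b a =
      (t - 1) * exchangeParam z₁ z₂ b * coreWeight₂ t (z₁ * k) (z₂ * k) none none a b +
      (z₁ - t * z₂) * coreWeight₂ t (z₂ * k) (z₁ * k) none none a b := by
  rcases a with _ | a
  · exact absurd hba (by simp [Below])
  rcases b with _ | b
  · simp [coreWeight₂, coreWeight, leftFactor', rightFactor', leftFactor, rightFactor,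
      exchangeParam]
    field_simp
    ring
  · have hba' : b < a := hba
    simp [coreWeight₂, coreWeight, leftFactor', rightFactor', leftFactor, rightFactor,
      exchangeParam, hba', hba'.not_gt]
    field_simp
    ring

/-- The comparison of coefficients when both right edges are uncolored; there the relation says that
the parameters of the two rows may be interchanged. -/
lemma coreWeight₂_exchange_right_none {t k z₁ z₂ : F} {c d : Option (Fin n)}
    (hdc : Below d c) :
    ((z₂ - z₁) * coreWeight₂ t (z₁ * k) (z₂ * k) c d none none +
      coreWeight₂ t (z₁ * k) (z₂ * k) d c none none * ((t - 1) * exchangeParam z₁ z₂ d) =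
      -(coreWeight₂ t (z₂ * k) (z₁ * k) d c none none * (z₂ - t * z₁))) ∧
    (coreWeight₂ t (z₁ * k) (z₂ * k) d c none none * (z₁ - t * z₂) =
      (z₂ - z₁) * coreWeight₂ t (z₂ * k) (z₁ * k) c d none none -
        coreWeight₂ t (z₂ * k) (z₁ * k) d c none none * ((t - 1) * exchangeParam z₂ z₁ d)) := by
  rcases c with _ | c
  · exact absurd hdc (by simp [Below])
  rcases d with _ | d
  · simp only [coreWeight₂, coreWeight, leftFactor', rightFactor', leftFactor, rightFactor,
      exchangeParam, reduceCtorEq, ne_eq, not_true_eq_false, and_false, if_false]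
    constructor <;> field_simp <;> ring
  · have hdc' : d < c := hdc
    simp only [coreWeight₂, coreWeight, leftFactor', rightFactor', leftFactor, rightFactor,
      exchangeParam, reduceCtorEq, ne_eq, not_true_eq_false, and_false, if_false, hdc', if_true,
      hdc'.not_gt]
    constructor <;> field_simp <;> ring

lemma balanced_swap_left {c d a b : Option (Fin n)} {T B : Finset (Fin n)} :
    Balanced c d a b T B ↔ Balanced d c a b T B := by
  unfold Balanced
  rw [Finset.union_comm c.toFinset]
  refine and_congr_left fun _ => forall_congr' fun e => imp_congr_right fun _ => ?_
  tauto

lemma balanced_swap_right {c d a b : Option (Fin n)} {T B : Finset (Fin n)} :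
    Balanced c d a b T B ↔ Balanced c d b a T B := by
  unfold Balanced
  rw [Finset.union_comm a.toFinset]
  refine and_congr (forall_congr' fun e => ?_) (and_congr_left fun _ => ?_)
  · rw [or_comm]
  · exact ⟨fun h e he he' => h e he' he, fun h e he he' => h e he' he⟩

lemma passing_swap_left (t : F) (c d a b : Option (Fin n)) (T : Finset (Fin n)) :
    passing t c d a b T = passing t d c a b T := by
  unfold passing; ring

lemma passing_swap_right (t : F) (c d a b : Option (Fin n)) (T : Finset (Fin n)) :
    passing t c d a b T = passing t c d b a T := by
  unfold passing; ring

/-- The weight of two rows with right boundary edges `a`, `b` from top to bottom and uncolored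
left boundary edges. -/
def twoRowWeight {K : ℕ} (t : F) (z₁ z₂ : Fin K → F) (a b : Option (Fin n))
    (top bottom : Fin K → Finset (Fin n)) : F :=
  ∑ M, rowWeight t z₁ a top M * rowWeight t z₂ b M bottom

lemma twoRowWeight_zero (t : F) (z₁ z₂ : Fin 0 → F) (a b : Option (Fin n))
    (top bottom : Fin 0 → Finset (Fin n)) :
    twoRowWeight t z₁ z₂ a b top bottom = if a = none ∧ b = none then 1 else 0 := by
  simp only [twoRowWeight, rowWeight_zero]
  by_cases ha : a = none <;> simp [ha]

lemma twoRowWeight_succ {K : ℕ} (t : F) (z₁ z₂ : Fin (K + 1) → F) (a b : Option (Fin n))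
    (top bottom : Fin (K + 1) → Finset (Fin n)) :
    twoRowWeight t z₁ z₂ a b top bottom =
      ∑ c, ∑ d, vertexWeight₂ t (z₁ 0) (z₂ 0) c d a b (top 0) (bottom 0) *
        twoRowWeight t (fun j => z₁ j.succ) (fun j => z₂ j.succ) c d
          (fun j => top j.succ) (fun j => bottom j.succ) := by
  rw [twoRowWeight, ← (Fin.consEquiv fun _ => Finset (Fin n)).sum_comp, Fintype.sum_prod_type]
  simp only [rowWeight_succ, Fin.consEquiv_apply, Fin.cons_zero, Fin.cons_succ, twoRowWeight,
    vertexWeight₂, Finset.sum_mul_sum]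
  rw [Finset.sum_congr rfl fun x _ => Finset.sum_comm, Finset.sum_comm]
  refine Finset.sum_congr rfl fun c _ => ?_
  rw [Finset.sum_congr rfl fun x _ => Finset.sum_comm, Finset.sum_comm]
  refine Finset.sum_congr rfl fun d _ => Finset.sum_congr rfl fun x _ =>
    Finset.sum_congr rfl fun y _ => ?_
  ring

/-- The multiplicity of a color on an optional edge. -/
def edgeCount (a : Option (Fin n)) (e : Fin n) : ℕ := if a = some e then 1 else 0

/-- The multiplicity of a color on a row of vertical edges. -/
def colorCount {K : ℕ} (T : Fin K → Finset (Fin n)) (e : Fin n) : ℕ :=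
  ∑ j, if e ∈ T j then 1 else 0

lemma colorCount_succ {K : ℕ} (T : Fin (K + 1) → Finset (Fin n)) (e : Fin n) :
    colorCount T e = (if e ∈ T 0 then 1 else 0) + colorCount (fun j => T j.succ) e :=
  Fin.sum_univ_succ _

lemma edgeCount_add_of_vertexWeight_ne_zero {R : Type*} [CommRing R] {t z : R}
    {l : Option (Fin n)} {T : Finset (Fin n)}
    {r : Option (Fin n)} {B : Finset (Fin n)} (h : vertexWeight t z l T r B ≠ 0) (e : Fin n) :
    edgeCount l e + (if e ∈ T then 1 else 0) = edgeCount r e + (if e ∈ B then 1 else 0) := by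
  rcases l with _ | c <;> rcases r with _ | d <;> simp only [vertexWeight] at h
  · have : B = T := by by_contra h'; simp [h'] at h
    simp [this]
  · have : d ∈ T ∧ B = T.erase d := by by_contra h'; simp [h'] at h
    obtain ⟨h1, rfl⟩ := this
    simp only [edgeCount, Finset.mem_erase, Option.some.injEq, reduceCtorEq, if_false]
    by_cases hde : d = e
    · subst hde; simp [h1]
    · simp [hde, Ne.symm hde]
  · have : c ∉ T ∧ B = insert c T := by by_contra h'; simp [h'] at h
    obtain ⟨h1, rfl⟩ := this
    simp only [edgeCount, Finset.mem_insert, Option.some.injEq, reduceCtorEq, if_false]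
    by_cases hde : c = e
    · subst hde; simp [h1]
    · simp [hde, Ne.symm hde]
  · by_cases hcd : c = d
    · subst hcd
      have : B = T := by by_contra h'; simp [h'] at h
      simp [this]
    · rw [if_neg hcd] at h
      have : c ∉ T ∧ d ∈ T ∧ B = insert c (T.erase d) := by by_contra h'; simp [h'] at h
      obtain ⟨h1, h2, rfl⟩ := this
      simp only [edgeCount, Finset.mem_insert, Finset.mem_erase, Option.some.injEq]
      by_cases hce : c = e
      · subst hce; simp [h1, Ne.symm hcd]
      · by_cases hde : d = e
        · subst hde; simp [h2, hcd, Ne.symm hcd]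
        · simp [hce, hde, Ne.symm hce, Ne.symm hde]

lemma colorCount_of_rowWeight_ne_zero {R : Type*} [CommRing R] {K : ℕ} {t : R} {z : Fin K → R}
    {a : Option (Fin n)} {T B : Fin K → Finset (Fin n)} (h : rowWeight t z a T B ≠ 0)
    (e : Fin n) : colorCount T e = edgeCount a e + colorCount B e := by
  induction K generalizing a with
  | zero =>
    rw [rowWeight_zero] at h
    have : a = none := by by_contra h'; simp [h'] at h
    simp [this, colorCount, edgeCount]
  | succ K ih =>
    rw [rowWeight_succ] at h
    obtain ⟨c, _, hc⟩ := Finset.exists_ne_zero_of_sum_ne_zero h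
    have h1 := edgeCount_add_of_vertexWeight_ne_zero (left_ne_zero_of_mul hc) e
    have h2 := ih (right_ne_zero_of_mul hc)
    rw [colorCount_succ, colorCount_succ]
    omega

lemma colorCount_of_twoRowWeight_ne_zero {K : ℕ} {t : F} {z₁ z₂ : Fin K → F}
    {a b : Option (Fin n)} {T B : Fin K → Finset (Fin n)}
    (h : twoRowWeight t z₁ z₂ a b T B ≠ 0) (e : Fin n) :
    colorCount T e = edgeCount a e + edgeCount b e + colorCount B e := by
  obtain ⟨M, _, hM⟩ := Finset.exists_ne_zero_of_sum_ne_zero h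
  have h1 := colorCount_of_rowWeight_ne_zero (left_ne_zero_of_mul hM) e
  have h2 := colorCount_of_rowWeight_ne_zero (right_ne_zero_of_mul hM) e
  omega

/-- One more column on the right preserves the exchange relations: `X` and `Y` stand for the columns
already treated, and the two orders of the inner edges `c`, `d` are taken together. -/
lemma vertexWeight₂_exchange {t k z₁ z₂ : F} (ht : t ≠ 0) (hz : z₁ ≠ z₂)
    {a b c d : Option (Fin n)} {T B : Finset (Fin n)} (hba : Below b a) (hdc : Below d c)
    (hc : ∀ e, c = some e → e ∉ T) (hd : ∀ e, d = some e → e ∉ T)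
    {X Y : Option (Fin n) → Option (Fin n) → F}
    (hX : ExchangeRel t z₁ z₂ X Y) (hY : ExchangeRel t z₂ z₁ Y X) :
    (z₂ - z₁) * (vertexWeight₂ t (z₁ * k) (z₂ * k) c d b a T B * X c d +
        vertexWeight₂ t (z₁ * k) (z₂ * k) d c b a T B * X d c) =
      (t - 1) * exchangeParam z₁ z₂ b *
        (vertexWeight₂ t (z₁ * k) (z₂ * k) c d a b T B * X c d +
        vertexWeight₂ t (z₁ * k) (z₂ * k) d c a b T B * X d c) +
      (z₁ - t * z₂) * (vertexWeight₂ t (z₂ * k) (z₁ * k) c d a b T B * Y c d +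
        vertexWeight₂ t (z₂ * k) (z₁ * k) d c a b T B * Y d c) := by
  classical
  have hcd : ∀ e, c = some e → d ≠ some e := by
    rintro e rfl rfl
    exact lt_irrefl _ hdc
  have hdc' : ∀ e, d = some e → c ≠ some e := fun e h h' => hcd e h' h
  simp only [vertexWeight₂_eq ht _ _ c d _ _ T B hc hd hcd,
    vertexWeight₂_eq ht _ _ d c _ _ T B hd hc hdc', balanced_swap_left (c := d) (d := c),
    passing_swap_left t d c, balanced_swap_right (a := b) (b := a), passing_swap_right t c d b a]
  split_ifs with hbal
  · obtain ⟨h1, h2⟩ := coreWeight₂_exchange (z₁ := z₁) (z₂ := z₂) (k := k) ht hba hdc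
    have r1 := hX d c hdc
    have r2 := hY d c hdc
    -- The factor `z₂ - z₁` makes it possible to eliminate `X d c` and `Y d c` by `r1` and `r2`
    -- without dividing.
    refine mul_left_cancel₀ (sub_ne_zero.2 hz.symm) ?_
    generalize passing t c d a b T = P
    linear_combination P * X c d * h1 + P * (z₁ - t * z₂) * Y c d * h2 +
      P * ((z₂ - z₁) * coreWeight₂ t (z₁ * k) (z₂ * k) d c b a -
        (t - 1) * exchangeParam z₁ z₂ b * coreWeight₂ t (z₁ * k) (z₂ * k) d c a b) * r1 +
      P * (z₁ - t * z₂) * coreWeight₂ t (z₂ * k) (z₁ * k) d c a b * r2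
  · simp

lemma vertexWeight₂_exchange_right_none {t k z₁ z₂ : F} (ht : t ≠ 0) (hz : z₁ ≠ z₂)
    {c d : Option (Fin n)} {T B : Finset (Fin n)} (hdc : Below d c)
    (hc : ∀ e, c = some e → e ∉ T) (hd : ∀ e, d = some e → e ∉ T)
    {X Y : Option (Fin n) → Option (Fin n) → F}
    (hX : ExchangeRel t z₁ z₂ X Y) (hY : ExchangeRel t z₂ z₁ Y X) :
    vertexWeight₂ t (z₁ * k) (z₂ * k) c d none none T B * X c d +
        vertexWeight₂ t (z₁ * k) (z₂ * k) d c none none T B * X d c =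
      vertexWeight₂ t (z₂ * k) (z₁ * k) c d none none T B * Y c d +
        vertexWeight₂ t (z₂ * k) (z₁ * k) d c none none T B * Y d c := by
  classical
  have hcd : ∀ e, c = some e → d ≠ some e := by
    rintro e rfl rfl
    exact lt_irrefl _ hdc
  have hdc' : ∀ e, d = some e → c ≠ some e := fun e h h' => hcd e h' h
  simp only [vertexWeight₂_eq ht _ _ c d _ _ T B hc hd hcd,
    vertexWeight₂_eq ht _ _ d c _ _ T B hd hc hdc', balanced_swap_left (c := d) (d := c),
    passing_swap_left t d c]
  split_ifs with hbal
  · obtain ⟨h1, h2⟩ := coreWeight₂_exchange_right_none (t := t) (z₁ := z₁) (z₂ := z₂) (k := k) hdc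
    have r1 := hX d c hdc
    have r2 := hY d c hdc
    refine mul_left_cancel₀ (sub_ne_zero.2 hz.symm) ?_
    generalize passing t c d none none T = P
    linear_combination P * X c d * h1 + P * Y c d * h2 +
      P * coreWeight₂ t (z₁ * k) (z₂ * k) d c none none * r1 +
      P * coreWeight₂ t (z₂ * k) (z₁ * k) d c none none * r2
  · simp

lemma below_trichotomy (a b : Option (Fin n)) : Below a b ∨ a = b ∨ Below b a := by
  rcases a with _ | a <;> rcases b with _ | b <;> simp [Below, lt_trichotomy]

/-- Pairing `(c, d)` with `(d, c)` counts the sum twice, which is why characteristic zero is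
assumed. -/
lemma sum_sum_eq_zero_of_antisymm [CharZero F] {ι : Type*} [Fintype ι] (D : ι → ι → F)
    (h : ∀ c d, D c d + D d c = 0) : ∑ c, ∑ d, D c d = 0 := by
  have h1 : ∑ c, ∑ d, D c d + ∑ c, ∑ d, D c d = 0 := by
    conv_lhs => enter [2]; rw [Finset.sum_comm]
    rw [← Finset.sum_add_distrib]
    refine Finset.sum_eq_zero fun c _ => ?_
    rw [← Finset.sum_add_distrib]
    exact Finset.sum_eq_zero fun d _ => h c d
  exact add_self_eq_zero.1 h1

/-- The two statements need a joint induction: the symmetry for uncolored right edges handles the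
diagonal term `c = d = none` when a column is added, and its own proof uses the exchange relations.
With no columns, both sides of an exchange relation vanish because `a` is colored and the left
boundary is not. -/
theorem twoRowWeight_exchange [CharZero F] {t : F} (ht : t ≠ 0) {K : ℕ} (k : Fin K → F)
    {T : Fin K → Finset (Fin n)} (hT : ∀ e, colorCount T e ≤ 1) (B : Fin K → Finset (Fin n))
    {z₁ z₂ : F} (hz : z₁ ≠ z₂) :
    ExchangeRel t z₁ z₂
      (fun a b => twoRowWeight t (fun j => z₁ * k j) (fun j => z₂ * k j) a b T B)
      (fun a b => twoRowWeight t (fun j => z₂ * k j) (fun j => z₁ * k j) a b T B) ∧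
    twoRowWeight t (fun j => z₁ * k j) (fun j => z₂ * k j) none none T B =
      twoRowWeight t (fun j => z₂ * k j) (fun j => z₁ * k j) none none T B := by
  classical
  induction K generalizing z₁ z₂ with
  | zero =>
    refine ⟨fun b a hba => ?_, by simp [twoRowWeight_zero]⟩
    have : a ≠ none := by rintro rfl; cases b <;> exact hba
    simp [twoRowWeight_zero, this]
  | succ K ih =>
    have hT' : ∀ e, colorCount (fun j => T j.succ) e ≤ 1 := fun e => by
      have := hT e
      rw [colorCount_succ] at this
      omega
    obtain ⟨hX, hX0⟩ := ih (fun j => k j.succ) hT' (fun j => B j.succ) hz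
    obtain ⟨hY, -⟩ := ih (fun j => k j.succ) hT' (fun j => B j.succ) hz.symm
    -- By conservation of colors, a nonzero weight here would make some color occur twice in `T`.
    have hvanish : ∀ z₁ z₂ : Fin K → F, ∀ c d : Option (Fin n),
        ((∃ e, c = some e ∧ e ∈ T 0) ∨ (∃ e, d = some e ∧ e ∈ T 0) ∨ (c = d ∧ c ≠ none)) →
        twoRowWeight t z₁ z₂ c d (fun j => T j.succ) (fun j => B j.succ) = 0 := by
      intro z₁ z₂ c d h
      by_contra hne
      have key : ∃ e, 1 < edgeCount c e + edgeCount d e + (if e ∈ T 0 then 1 else 0) := by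
        rcases h with ⟨e, rfl, he⟩ | ⟨e, rfl, he⟩ | ⟨rfl, h⟩
        · exact ⟨e, by simp [edgeCount, he]⟩
        · exact ⟨e, by simp [edgeCount, he]⟩
        · obtain ⟨e, rfl⟩ := Option.ne_none_iff_exists'.1 h
          exact ⟨e, by simp [edgeCount]; omega⟩
      obtain ⟨e, he⟩ := key
      have h1 := colorCount_of_twoRowWeight_ne_zero hne e
      have h2 := hT e
      rw [colorCount_succ] at h2
      omega
    set X : Option (Fin n) → Option (Fin n) → F := fun a b =>
      twoRowWeight t (fun j : Fin K => z₁ * k j.succ) (fun j => z₂ * k j.succ) a b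
        (fun j => T j.succ) (fun j => B j.succ) with hXdef
    set Y : Option (Fin n) → Option (Fin n) → F := fun a b =>
      twoRowWeight t (fun j : Fin K => z₂ * k j.succ) (fun j => z₁ * k j.succ) a b
        (fun j => T j.succ) (fun j => B j.succ) with hYdef
    have hXv : ∀ c d, ((∃ e, c = some e ∧ e ∈ T 0) ∨ (∃ e, d = some e ∧ e ∈ T 0) ∨
        (c = d ∧ c ≠ none)) → X c d = 0 := fun c d => hvanish _ _ c d
    have hYv : ∀ c d, ((∃ e, c = some e ∧ e ∈ T 0) ∨ (∃ e, d = some e ∧ e ∈ T 0) ∨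
        (c = d ∧ c ≠ none)) → Y c d = 0 := fun c d => hvanish _ _ c d
    have h00 : X none none = Y none none := hX0
    refine ⟨fun b a hba => ?_, ?_⟩
    · simp only [twoRowWeight_succ]
      rw [← sub_eq_zero]
      have := sum_sum_eq_zero_of_antisymm (fun c d =>
        (z₂ - z₁) * (vertexWeight₂ t (z₁ * k 0) (z₂ * k 0) c d b a (T 0) (B 0) * X c d) -
        ((t - 1) * exchangeParam z₁ z₂ b *
          (vertexWeight₂ t (z₁ * k 0) (z₂ * k 0) c d a b (T 0) (B 0) * X c d) +
        (z₁ - t * z₂) * (vertexWeight₂ t (z₂ * k 0) (z₁ * k 0) c d a b (T 0) (B 0) * Y c d))) ?_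
      · simpa only [Finset.sum_sub_distrib, Finset.sum_add_distrib, ← Finset.mul_sum] using this
      · have main : ∀ c d, Below d c → (z₂ - z₁) * (vertexWeight₂ t (z₁ * k 0) (z₂ * k 0) c d b a
            (T 0) (B 0) * X c d + vertexWeight₂ t (z₁ * k 0) (z₂ * k 0) d c b a (T 0) (B 0) * X d c) =
            (t - 1) * exchangeParam z₁ z₂ b *
              (vertexWeight₂ t (z₁ * k 0) (z₂ * k 0) c d a b (T 0) (B 0) * X c d +
              vertexWeight₂ t (z₁ * k 0) (z₂ * k 0) d c a b (T 0) (B 0) * X d c) +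
            (z₁ - t * z₂) * (vertexWeight₂ t (z₂ * k 0) (z₁ * k 0) c d a b (T 0) (B 0) * Y c d +
              vertexWeight₂ t (z₂ * k 0) (z₁ * k 0) d c a b (T 0) (B 0) * Y d c) := by
          intro c d hdc
          by_cases hc : ∃ e, c = some e ∧ e ∈ T 0
          · simp [hXv c d (.inl hc), hXv d c (.inr (.inl hc)), hYv c d (.inl hc),
              hYv d c (.inr (.inl hc))]
          by_cases hd : ∃ e, d = some e ∧ e ∈ T 0
          · simp [hXv d c (.inl hd), hXv c d (.inr (.inl hd)), hYv d c (.inl hd),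
              hYv c d (.inr (.inl hd))]
          push Not at hc hd
          exact vertexWeight₂_exchange ht hz hba hdc hc hd hX hY
        intro c d
        rcases below_trichotomy d c with h | rfl | h
        · linear_combination main c d h
        · by_cases hd : d = none
          · subst hd
            simp only [vertexWeight₂_eq ht _ _ none none _ _ (T 0) (B 0) (by simp) (by simp)
              (by simp), h00, balanced_swap_right (a := b) (b := a),
              passing_swap_right t none none b a]
            have := coreWeight₂_exchange_left_none (k := k 0) (z₁ := z₁) (z₂ := z₂) ht hba
            split_ifs
            · linear_combination 2 * passing t none none a b (T 0) * Y none none * this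
            · simp
          · simp [hXv d d (.inr (.inr ⟨rfl, hd⟩)), hYv d d (.inr (.inr ⟨rfl, hd⟩))]
        · linear_combination main d c h
    · simp only [twoRowWeight_succ]
      rw [← sub_eq_zero]
      have := sum_sum_eq_zero_of_antisymm (fun c d =>
        vertexWeight₂ t (z₁ * k 0) (z₂ * k 0) c d none none (T 0) (B 0) * X c d -
        vertexWeight₂ t (z₂ * k 0) (z₁ * k 0) c d none none (T 0) (B 0) * Y c d) ?_
      · simpa only [Finset.sum_sub_distrib] using this
      · have main : ∀ c d, Below d c → vertexWeight₂ t (z₁ * k 0) (z₂ * k 0) c d none none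
            (T 0) (B 0) * X c d +
              vertexWeight₂ t (z₁ * k 0) (z₂ * k 0) d c none none (T 0) (B 0) * X d c =
            vertexWeight₂ t (z₂ * k 0) (z₁ * k 0) c d none none (T 0) (B 0) * Y c d +
              vertexWeight₂ t (z₂ * k 0) (z₁ * k 0) d c none none (T 0) (B 0) * Y d c := by
          intro c d hdc
          by_cases hc : ∃ e, c = some e ∧ e ∈ T 0
          · simp [hXv c d (.inl hc), hXv d c (.inr (.inl hc)), hYv c d (.inl hc),
              hYv d c (.inr (.inl hc))]
          by_cases hd : ∃ e, d = some e ∧ e ∈ T 0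
          · simp [hXv d c (.inl hd), hXv c d (.inr (.inl hd)), hYv d c (.inl hd),
              hYv c d (.inr (.inl hd))]
          push Not at hc hd
          exact vertexWeight₂_exchange_right_none ht hz hdc hc hd hX hY
        intro c d
        rcases below_trichotomy d c with h | rfl | h
        · linear_combination main c d h
        · by_cases hd : d = none
          · subst hd
            simp only [vertexWeight₂_eq ht _ _ none none _ _ (T 0) (B 0) (by simp) (by simp)
              (by simp), h00]
            simp [coreWeight₂, coreWeight]
          · simp [hXv d d (.inr (.inr ⟨rfl, hd⟩)), hYv d d (.inr (.inr ⟨rfl, hd⟩))]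
        · linear_combination main d c h

end Exchange

/-! ### The partition function: exchange relation and base case -/

lemma colorCount_singleton_le {n : ℕ} (σ : Perm (Fin n)) (e : Fin n) :
    colorCount (fun j => {σ j}) e ≤ 1 := by
  simp only [colorCount, Finset.mem_singleton, ← Finset.card_filter]
  refine Finset.card_le_one.2 fun a ha b hb => σ.injective ?_
  rw [← (Finset.mem_filter.1 ha).2, ← (Finset.mem_filter.1 hb).2]

/-- The two-row relation with `z₁ = x_i`, `z₂ = x_{i+1}` and right edges `w(i+1) < w(i)`, inserted
into the path sum over rows. The invariant is that no color occurs twice on a row of vertical edges;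
it holds at the top and is inherited downwards. -/
theorem partitionFn_exchange {n : ℕ} {F : Type*} [Field F] [CharZero F] {t : F} (ht : t ≠ 0)
    (x y : Fin n → Fˣ) (σ w : Perm (Fin n)) {i : ℕ} (hi : i + 1 < n)
    (hw : w ⟨i + 1, hi⟩ < w ⟨i, Nat.lt_of_succ_lt hi⟩)
    (hx : x ⟨i, Nat.lt_of_succ_lt hi⟩ ≠ x ⟨i + 1, hi⟩) :
    ((x ⟨i + 1, hi⟩ : F) - x ⟨i, Nat.lt_of_succ_lt hi⟩) *
        partitionFn t x y σ (w * simpleRefl i hi) =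
      (t - 1) * x ⟨i + 1, hi⟩ * partitionFn t x y σ w +
      ((x ⟨i, Nat.lt_of_succ_lt hi⟩ : F) - t * x ⟨i + 1, hi⟩) *
        partitionFn t (fun k => x (simpleRefl i hi k)) y σ w := by
  simp only [partitionFn_eq_pathSum]
  refine pathSum_exchange (fun T : Fin n → Finset (Fin n) => ∀ e, colorCount T e ≤ 1) hi _ _ _ _ _ _
    ?_ ?_ ?_ ?_ (colorCount_singleton_le σ) _
  · intro j h1 h2
    simp only [Perm.mul_apply, simpleRefl_of_ne hi h1 h2]
  · intro j h1 h2
    simp only [Perm.mul_apply, simpleRefl_of_ne hi h1 h2]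
  · intro j s c hs hne e
    have := colorCount_of_rowWeight_ne_zero hne e
    have := hs e
    omega
  · intro s e hs
    have h := (twoRowWeight_exchange ht (fun j => ((y j)⁻¹ : F)) hs e
      (z₁ := x ⟨i, Nat.lt_of_succ_lt hi⟩) (z₂ := x ⟨i + 1, hi⟩)
      (fun h => hx (Units.ext h))).1 (some (w ⟨i + 1, hi⟩)) (some (w ⟨i, Nat.lt_of_succ_lt hi⟩)) hw
    simp only [exchangeParam, twoRowWeight] at h
    simpa only [Perm.mul_apply, simpleRefl_left, simpleRefl_right, Units.val_mul,
      Units.val_inv_eq_inv_val] using h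

/-! ### The unique state for `w = u w₀` -/

section BaseCase

variable {n : ℕ} {R : Type*} [CommRing R]

lemma pathSum_of_deterministic {A : Type*} [Fintype A] [DecidableEq A] {m : ℕ}
    (f : Fin m → A → A → R) (p : Fin (m + 1) → A) (W : Fin m → R)
    (h : ∀ i c, f i (p i.castSucc) c = if c = p i.succ then W i else 0) :
    pathSum m f (p 0) (p (Fin.last m)) = ∏ i, W i := by
  induction m with
  | zero => simp [pathSum_zero]
  | succ m ih =>
    rw [pathSum_succ, Fin.prod_univ_succ, Finset.sum_eq_single (p 1)]
    · have h0 := h 0 (p 1)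
      simp only [Fin.castSucc_zero, Fin.succ_zero_eq_one, if_true] at h0
      rw [h0]
      congr 1
      exact ih (fun i => f i.succ) (fun i => p i.succ) (fun i => W i.succ) fun i c => h i.succ c
    · intro c _ hc
      have h0 : f 0 (p 0) c = 0 := (h 0 c).trans (if_neg hc)
      rw [h0, zero_mul]
    · simp

lemma rowWeight_of_empty {K : ℕ} (t : R) (z : Fin K → R) (a : Option (Fin n))
    (B : Fin K → Finset (Fin n)) :
    rowWeight t z a (fun _ => ∅) B = if a = none ∧ B = fun _ => ∅ then 1 else 0 := by
  induction K generalizing a with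
  | zero => simp [rowWeight_zero, funext_iff]
  | succ K ih =>
    rw [rowWeight_succ, Finset.sum_eq_single none]
    · rw [ih]
      have : (B = fun _ => ∅) ↔ B 0 = ∅ ∧ (fun j : Fin K => B j.succ) = fun _ => ∅ := by
        rw [funext_iff, funext_iff, Fin.forall_fin_succ]
      simp only [this]
      by_cases hb : B 0 = ∅ <;> cases a <;> simp [vertexWeight, hb]
    · intro c _ hc
      rw [ih, if_neg fun h => hc h.1, mul_zero]
    · simp

lemma vertexWeight_of_notMem (t z : R) {c : Fin n} {T : Finset (Fin n)} (hc : c ∉ T)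
    (l : Option (Fin n)) (B : Finset (Fin n)) :
    vertexWeight t z l T (some c) B =
      if l = some c ∧ B = T then t ^ (T.filter (c < ·)).card * (1 - z) else 0 := by
  rcases l with _ | d
  · simp [vertexWeight, hc]
  · by_cases h : d = c
    · subst h
      simp [vertexWeight, hc]
    · simp [vertexWeight, hc, h]

/-- A row whose right boundary color `c` comes down in column `m`, with no colors to the left of
that column. -/
lemma rowWeight_of_singleton {K : ℕ} (t : R) (z : Fin K → R) (c : Fin n)
    (T S B : Fin K → Finset (Fin n)) (m : ℕ) (hm : m < K) (hTm : T ⟨m, hm⟩ = {c})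
    (hlt : ∀ j : Fin K, (j : ℕ) < m → c ∉ T j ∧ S j = T j)
    (hgt : ∀ j : Fin K, m < j → T j = ∅) (hS : ∀ j : Fin K, m ≤ j → S j = ∅) :
    rowWeight t z (some c) T B = if B = S then
      ∏ j : Fin K, (if (j : ℕ) < m then t ^ ((T j).filter (c < ·)).card * (1 - z j) else 1)
      else 0 := by
  induction K generalizing m with
  | zero => exact absurd hm (by simp)
  | succ K ih =>
    have hB : B = S ↔ B 0 = S 0 ∧ (fun j : Fin K => B j.succ) = fun j => S j.succ := by
      rw [funext_iff, funext_iff, Fin.forall_fin_succ]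
    cases m with
    | zero =>
      have hT' : (fun j : Fin K => T j.succ) = fun _ => ∅ := funext fun j => hgt _ (by simp)
      have hS' : (fun j : Fin K => S j.succ) = fun _ => ∅ := funext fun j => hS _ (by simp)
      have hT0 : T 0 = {c} := hTm
      have hS0 : S 0 = ∅ := hS 0 (by simp)
      rw [rowWeight_succ, hT', Finset.sum_eq_single none]
      · rw [rowWeight_of_empty]
        by_cases hb : B 0 = ∅ <;>
          simp [hB, hS', hS0, hT0, vertexWeight, hb, Finset.filter_singleton]
      · intro l _ hl
        rw [rowWeight_of_empty, if_neg fun h => hl h.1, mul_zero]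
      · simp
    | succ m =>
      obtain ⟨hc0, hS0⟩ := hlt 0 (by simp)
      rw [rowWeight_succ, Finset.sum_eq_single (some c)]
      · rw [ih (fun j => z j.succ) (fun j => T j.succ) (fun j => S j.succ) (fun j => B j.succ) m
          (by omega) hTm (fun j hj => hlt j.succ (by simpa using hj))
          (fun j hj => hgt j.succ (by simpa using hj))
          (fun j hj => hS j.succ (by simpa using hj)), vertexWeight_of_notMem t (z 0) hc0,
          Fin.prod_univ_succ]
        by_cases hb : B 0 = T 0 <;> simp [hB, hS0, hb]
      · intro l _ hl
        rw [vertexWeight_of_notMem t (z 0) hc0, if_neg fun h => hl h.1, zero_mul]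
      · simp

/-- From top to bottom, each row removes the color in the leftmost occupied column. This color turns
right there and crosses every column further to the right, so the state is forced and its weight is
the product over the crossings. -/
lemma partitionFn_mul_longElt (t : R) (x y : Fin n → Rˣ) (u : Perm (Fin n)) :
    partitionFn t x y u (u * longElt n) = t ^ len u *
      ∏ p ∈ Finset.univ.filter
          (fun p : Fin n × Fin n => ((p.1 : ℕ) + 1) + ((p.2 : ℕ) + 1) ≤ n),
        (1 - ((x p.1 * (y p.2)⁻¹ : Rˣ) : R)) := by
  classical
  let V : Fin (n + 1) → Fin n → Finset (Fin n) :=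
    fun i j => if (i : ℕ) + j < n then {u j} else ∅
  have hV0 : V 0 = fun j => {u j} := by
    funext j; simp [V]
  have hVl : V (Fin.last n) = fun _ => ∅ := by
    funext j; simp [V]
  rw [partitionFn_eq_pathSum, ← hV0, ← hVl, pathSum_of_deterministic _ V
    fun i => ∏ j : Fin n, if (i : ℕ) + j + 1 < n then
      t ^ (if u i.rev < u j then 1 else 0) * (1 - ((x i * (y j)⁻¹ : Rˣ) : R)) else 1]
  · rw [← Fintype.prod_prod_type' (fun i j : Fin n => if (i : ℕ) + j + 1 < n then
      t ^ (if u i.rev < u j then 1 else 0) * (1 - ((x i * (y j)⁻¹ : Rˣ) : R)) else 1),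
      ← Finset.prod_filter, Finset.prod_mul_distrib, Finset.prod_pow_eq_pow_sum]
    congr 1
    · congr 1
      rw [← Finset.card_filter, len_eq]
      -- The crossing of row `i` with column `j` corresponds to the positions `j < i.rev`; it
      -- contributes a factor `t` exactly when they form an inversion of `u`.
      refine Finset.card_nbij' (fun p => (p.2, p.1.rev)) (fun p => (p.2.rev, p.1)) ?_ ?_ ?_ ?_
      · rintro ⟨p, q⟩ h
        simp only [Finset.coe_filter, Finset.mem_filter, Finset.mem_univ, true_and,
          Set.mem_ofPred_eq] at h
        refine mem_inversions.2 ⟨?_, h.2⟩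
        simp only [Fin.lt_def, Fin.val_rev]
        omega
      · rintro ⟨p, q⟩ h
        have h := mem_inversions.1 h
        simp only [Finset.coe_filter, Finset.mem_filter, Finset.mem_univ, true_and,
          Set.mem_ofPred_eq, Fin.rev_rev]
        refine ⟨?_, h.2⟩
        have := h.1
        simp only [Fin.lt_def, Fin.val_rev] at this ⊢
        omega
      · rintro ⟨p, q⟩ _; simp
      · rintro ⟨p, q⟩ _; simp
    · refine Finset.prod_congr ?_ fun _ _ => rfl
      ext p
      simp only [Finset.mem_filter, Finset.mem_univ, true_and]
      omega
  · intro i c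
    have hi := i.isLt
    -- With indices from zero, row `i` meets the occupied columns `0, …, n - 1 - i`, and its color
    -- is the one in the last of them.
    rw [rowWeight_of_singleton t _ _ (V i.castSucc) (V i.succ) c (n - 1 - i) (by omega)]
    · refine if_congr Iff.rfl (Finset.prod_congr rfl fun j _ => ?_) rfl
      refine if_ctx_congr (by omega) (fun hj => ?_) fun _ => rfl
      have : (i : ℕ) + j < n := by omega
      simp only [V, Fin.val_castSucc, this, if_true, Finset.filter_singleton, Perm.mul_apply,
        longElt_apply]
      split_ifs <;> simp
    · have : (i : ℕ) + (n - 1 - i) < n := by omega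
      simp only [V, Fin.val_castSucc, this, if_true, Perm.mul_apply, longElt_apply]
      congr 2
      ext
      simp [Fin.val_rev]
      omega
    · intro j hj
      have h1 : (i : ℕ) + j < n := by omega
      have h2 : (i : ℕ) + 1 + j < n := by omega
      refine ⟨?_, by simp [V, h1, h2]⟩
      simp only [V, Fin.val_castSucc, h1, if_true, Finset.mem_singleton, Perm.mul_apply,
        longElt_apply]
      intro h
      have := congrArg Fin.val (u.injective h)
      simp only [Fin.val_rev] at this
      omega
    · intro j hj
      have : ¬ (i : ℕ) + j < n := by omega
      simp [V, this]
    · intro j hj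
      have : ¬ (i : ℕ) + 1 + j < n := by omega
      simp [V, this]

end BaseCase

/-! ### Monomials and substitutions -/

section Monomials

variable {n : ℕ} {R S : Type*} [CommRing R] [CommRing S]

lemma monomial_add (z : Fin n → Rˣ) (μ ν : Weight n) :
    monomial z (μ + ν) = monomial z μ * monomial z ν := by
  simp [monomial, zpow_add, Finset.prod_mul_distrib]

lemma monomial_neg (z : Fin n → Rˣ) (μ : Weight n) : monomial z (-μ) = (monomial z μ)⁻¹ := by
  simp [monomial]

lemma monomial_inv (z : Fin n → Rˣ) (μ : Weight n) :
    monomial (fun k => (z k)⁻¹) μ = (monomial z μ)⁻¹ := by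
  simp [monomial]

lemma map_monomial (φ : R →* S) (z : Fin n → Rˣ) (μ : Weight n) :
    Units.map φ (monomial z μ) = monomial (fun k => Units.map φ (z k)) μ := by
  simp only [monomial, map_prod, map_zpow]

lemma monomial_comp (z : Fin n → Rˣ) (w : Perm (Fin n)) (μ : Weight n) :
    monomial (fun k => z (w k)) μ = monomial z (act w μ) := by
  simp only [monomial, act]
  rw [← Equiv.prod_comp w fun k => z k ^ μ (w⁻¹ k)]
  simp

lemma monomial_root (z : Fin n → Rˣ) (p q : Fin n) :
    monomial z (root p q) = z p * (z q)⁻¹ := by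
  have hs : ∀ (p : Fin n), monomial z (Pi.single p 1) = z p := fun p => by
    rw [monomial, Finset.prod_eq_single p] <;> simp +contextual
  rw [root, sub_eq_add_neg, monomial_add, monomial_neg, hs, hs]

lemma act_add (w : Perm (Fin n)) (μ ν : Weight n) : act w (μ + ν) = act w μ + act w ν := rfl

lemma act_neg (w : Perm (Fin n)) (μ : Weight n) : act w (-μ) = -act w μ := rfl

lemma act_zsmul (w : Perm (Fin n)) (c : ℤ) (μ : Weight n) : act w (c • μ) = c • act w μ := rfl

lemma act_single (w : Perm (Fin n)) (p : Fin n) (c : ℤ) :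
    act w (Pi.single p c) = Pi.single (w p) c := by
  funext k
  simp only [act, Pi.single_apply, Perm.inv_eq_iff_eq]

lemma act_root (w : Perm (Fin n)) (p q : Fin n) : act w (root p q) = root (w p) (w q) := by
  rw [root, root, sub_eq_add_neg, act_add, act_neg, act_single, act_single, sub_eq_add_neg]

lemma simpleIndex_ne {i : ℕ} (hi : i + 1 < n) :
    (⟨i, Nat.lt_of_succ_lt hi⟩ : Fin n) ≠ ⟨i + 1, hi⟩ := by simp

lemma act_simpleRefl {i : ℕ} (hi : i + 1 < n) (μ : Weight n) :
    act (simpleRefl i hi) μ = μ + -corootPairing i hi μ • simpleRoot i hi := by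
  funext k
  have hinv : (simpleRefl i hi)⁻¹ = simpleRefl i hi := swap_inv _ _
  simp only [act, hinv, Pi.add_apply, Pi.smul_apply, simpleRoot, root, Pi.sub_apply,
    Pi.single_apply, corootPairing, smul_eq_mul]
  by_cases h1 : k = ⟨i, Nat.lt_of_succ_lt hi⟩
  · subst h1
    rw [simpleRefl_left, if_pos rfl, if_neg (simpleIndex_ne hi)]
    ring
  · by_cases h2 : k = ⟨i + 1, hi⟩
    · subst h2
      rw [simpleRefl_right, if_pos rfl, if_neg (simpleIndex_ne hi).symm]
      ring
    · rw [simpleRefl_of_ne hi (fun h => h1 (Fin.ext h)) (fun h => h2 (Fin.ext h)), if_neg h1,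
        if_neg h2]
      ring

end Monomials

/-! ### Substitutions of variables in Laurent polynomials -/

section Substitutions

lemma rename_gen {σ τ : Type} (f : σ → τ) (a : σ) :
    Units.map (rename f : Laurent σ →* Laurent τ) (gen a) = gen (f a) := by
  ext1
  simp [rename, gen, AddMonoidAlgebra.mapDomain_single, Finsupp.mapDomain_single]

lemma rename_rename {σ τ υ : Type} (f : σ → τ) (g : τ → υ) (p : Laurent σ) :
    rename g (rename f p) = rename (g ∘ f) p := by
  simp only [rename]
  rw [← RingHom.comp_apply, ← AddMonoidAlgebra.mapDomainRingHom_comp]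
  congr 2
  ext
  simp

lemma rename_id {σ : Type} (p : Laurent σ) : rename id p = p := by
  simp [rename]

lemma gen_injective {σ : Type} : Function.Injective (gen : σ → (Laurent σ)ˣ) := by
  intro a b h
  have := congrArg Units.val h
  simp only [gen] at this
  rw [AddMonoidAlgebra.single_left_inj one_ne_zero] at this
  exact Finsupp.single_left_injective one_ne_zero this

instance charZero_laurent (σ : Type) : CharZero (Laurent σ) :=
  charZero_of_injective_ringHom (f := (AddMonoidAlgebra.singleZeroRingHom : ℤ →+* Laurent σ))
    (fun _ _ h => AddMonoidAlgebra.single_right_injective h)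

variable {n : ℕ}

lemma permX_xv (w : Perm (Fin n)) (i : Fin n) :
    Units.map (permX w : LXY n →* LXY n) (xv i) = xv (w i) := rename_gen _ _

lemma permX_yv (w : Perm (Fin n)) (i : Fin n) :
    Units.map (permX w : LXY n →* LXY n) (yv i) = yv i := rename_gen _ _

lemma permX_qh (w : Perm (Fin n)) :
    Units.map (permX w : LXY n →* LXY n) (qh n) = qh n := rename_gen _ _

lemma restrict_xv (v : Perm (Fin n)) (i : Fin n) :
    Units.map (restrict v : LXY n →* LY n) (xv i) = yY (v i) := rename_gen _ _

lemma restrict_yv (v : Perm (Fin n)) (i : Fin n) :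
    Units.map (restrict v : LXY n →* LY n) (yv i) = yY i := rename_gen _ _

lemma restrict_qh (v : Perm (Fin n)) :
    Units.map (restrict v : LXY n →* LY n) (qh n) = qhY n := rename_gen _ _

lemma restrict_permX (v w : Perm (Fin n)) (f : LXY n) :
    restrict v (permX w f) = restrict (v * w) f := by
  rw [restrict, permX, rename_rename, restrict]
  congr 2
  funext a
  cases a <;> rfl

lemma permX_permX (v w : Perm (Fin n)) (f : LXY n) :
    permX v (permX w f) = permX (v * w) f := by
  rw [permX, permX, rename_rename, permX]
  congr 2
  funext a
  cases a <;> rfl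

lemma permX_one (f : LXY n) : permX 1 f = f := by
  conv_rhs => rw [← rename_id f]
  rw [permX]
  congr 2
  funext a
  cases a <;> rfl

lemma xv_injective : Function.Injective (xv : Fin n → (LXY n)ˣ) := fun _ _ h =>
  VarXY.x.inj (gen_injective h)

lemma yY_injective : Function.Injective (yY : Fin n → (LY n)ˣ) := fun _ _ h =>
  VarY.y.inj (gen_injective h)

end Substitutions

/-! ### The recursion for the stab polynomials -/

/-- The relation itself has no denominators; the field was needed only for the factorized weights,
which divide by `t`. -/
theorem partitionFn_exchange_of_isDomain {n : ℕ} {R : Type*} [CommRing R] [IsDomain R] [CharZero R]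
    {t : R} (ht : t ≠ 0)
    (x y : Fin n → Rˣ) (σ w : Perm (Fin n)) {i : ℕ} (hi : i + 1 < n)
    (hw : w ⟨i + 1, hi⟩ < w ⟨i, Nat.lt_of_succ_lt hi⟩)
    (hx : x ⟨i, Nat.lt_of_succ_lt hi⟩ ≠ x ⟨i + 1, hi⟩) :
    ((x ⟨i + 1, hi⟩ : R) - x ⟨i, Nat.lt_of_succ_lt hi⟩) *
        partitionFn t x y σ (w * simpleRefl i hi) =
      (t - 1) * x ⟨i + 1, hi⟩ * partitionFn t x y σ w +
      ((x ⟨i, Nat.lt_of_succ_lt hi⟩ : R) - t * x ⟨i + 1, hi⟩) *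
        partitionFn t (fun k => x (simpleRefl i hi k)) y σ w := by
  have hinj := IsFractionRing.injective R (FractionRing R)
  have : CharZero (FractionRing R) := charZero_of_injective_algebraMap hinj
  apply hinj
  have hu : Function.Injective (Units.map (algebraMap R (FractionRing R) : R →* FractionRing R)) :=
    Units.map_injective hinj
  have := partitionFn_exchange (F := FractionRing R)
    (t := algebraMap R (FractionRing R) t) (fun h => ht (hinj (by rw [h, map_zero])))
    (fun k => Units.map (algebraMap R (FractionRing R) : R →* FractionRing R) (x k))
    (fun k => Units.map (algebraMap R (FractionRing R) : R →* FractionRing R) (y k)) σ w hi hw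
    (fun h => hx (hu h))
  simpa only [map_mul, map_sub, map_add, map_one, map_partitionFn, Units.coe_map,
    MonoidHom.coe_coe] using this

section Recursion

variable {n : ℕ} (u : Perm (Fin n)) {i : ℕ} (hi : i + 1 < n)

/-- The monomial `x^{-α_i}`. -/
def rootMonomial {i : ℕ} (hi : i + 1 < n) : (LXY n)ˣ := monomial xv (-simpleRoot i hi)

/-- The monomial `x^{s_i μ - μ}` for `μ = w₀ u⁻¹ w₀ ρ`. -/
def shiftMonomial {i : ℕ} (hi : i + 1 < n) : (LXY n)ˣ :=
  monomial xv (-corootPairing i hi (twistedRho u) • simpleRoot i hi)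

/-- The equation `h = M_i^u g`, without denominators. -/
def StepRel (g h : LXY n) : Prop :=
  (1 - (rootMonomial hi : LXY n)) * h = (qh n : LXY n) *
    (((qh n ^ (-2 : ℤ) : (LXY n)ˣ) - 1 : LXY n) * g +
      (rootMonomial hi - (qh n ^ (-2 : ℤ) : (LXY n)ˣ) : LXY n) * (shiftMonomial u hi : LXY n) *
        permX (simpleRefl i hi) g)

lemma rootMonomial_eq : rootMonomial hi =
    (xv ⟨i, Nat.lt_of_succ_lt hi⟩)⁻¹ * xv ⟨i + 1, hi⟩ := by
  rw [rootMonomial, monomial_neg, simpleRoot, monomial_root, mul_inv, inv_inv]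

lemma one_sub_rootMonomial_ne_zero : 1 - (rootMonomial hi : LXY n) ≠ 0 := by
  intro h
  have h1 : rootMonomial hi = 1 := Units.ext (sub_eq_zero.1 h).symm
  rw [rootMonomial_eq, inv_mul_eq_one] at h1
  exact simpleIndex_ne hi (xv_injective h1)

lemma map_permX_monomial (w : Perm (Fin n)) (μ : Weight n) :
    Units.map (permX w : LXY n →* LXY n) (monomial xv μ) = monomial xv (act w μ) := by
  rw [map_monomial, ← monomial_comp]
  simp only [permX_xv]

lemma corootPairing_simpleRoot : corootPairing i hi (simpleRoot i hi) = 2 := by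
  simp [corootPairing, simpleRoot, root]

lemma act_simpleRefl_simpleRoot :
    act (simpleRefl i hi) (simpleRoot i hi) = -simpleRoot i hi := by
  rw [act_simpleRefl, corootPairing_simpleRoot, neg_smul, two_smul]
  abel

lemma permX_rootMonomial : Units.map (permX (simpleRefl i hi) : LXY n →* LXY n) (rootMonomial hi) =
    (rootMonomial hi)⁻¹ := by
  rw [rootMonomial, map_permX_monomial, act_neg, act_simpleRefl_simpleRoot, monomial_neg]

lemma permX_shiftMonomial :
    Units.map (permX (simpleRefl i hi) : LXY n →* LXY n) (shiftMonomial u hi) =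
      (shiftMonomial u hi)⁻¹ := by
  rw [shiftMonomial, map_permX_monomial, act_zsmul, act_simpleRefl_simpleRoot, smul_neg,
    monomial_neg]

/-- Conjugation by `x^μ`, with `μ = w₀ u⁻¹ w₀ ρ`, cancels in the term with `g` and leaves `x^{s_i μ
- μ}` in the term with `s_i g`. The denominator `1 - x^{-α_i}` is nonzero and can be cleared. -/
lemma algebraMap_eq_opM_iff (g h : LXY n) :
    algebraMap (LXY n) (FXY n) h = opM u i hi g ↔ StepRel u hi g h := by
  have hinj := IsFractionRing.injective (LXY n) (FXY n)
  have hne : 1 - algebraMap (LXY n) (FXY n) (rootMonomial hi : LXY n) ≠ 0 := by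
    rw [← map_one (algebraMap (LXY n) (FXY n)), ← map_sub]
    exact fun h => one_sub_rootMonomial_ne_zero hi (hinj (by rw [h, map_zero]))
  have h1 : monomial xv (-twistedRho u) * monomial xv (twistedRho u) = (1 : (LXY n)ˣ) := by
    rw [monomial_neg, inv_mul_cancel]
  have h2 : monomial xv (-twistedRho u) *
      Units.map (permX (simpleRefl i hi) : LXY n →* LXY n) (monomial xv (twistedRho u)) =
        shiftMonomial u hi := by
    rw [map_permX_monomial, act_simpleRefl, monomial_add, ← mul_assoc, h1, one_mul]; rfl
  have h1' := congrArg (fun a : (LXY n)ˣ => algebraMap (LXY n) (FXY n) a) h1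
  have h2' := congrArg (fun a : (LXY n)ˣ => algebraMap (LXY n) (FXY n) a) h2
  simp only [Units.val_mul, map_mul, Units.val_one, map_one, Units.coe_map, MonoidHom.coe_coe]
    at h1' h2'
  have key : (1 - algebraMap (LXY n) (FXY n) (rootMonomial hi : LXY n)) * opM u i hi g =
      algebraMap (LXY n) (FXY n) ((qh n : LXY n) *
    (((qh n ^ (-2 : ℤ) : (LXY n)ˣ) - 1 : LXY n) * g +
      (rootMonomial hi - (qh n ^ (-2 : ℤ) : (LXY n)ˣ) : LXY n) * (shiftMonomial u hi : LXY n) *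
        permX (simpleRefl i hi) g)) := by
    simp only [opM, tauBar, Units.val_mul, map_mul, map_add, map_sub, map_one]
    rw [← rootMonomial, ← h2']
    field_simp
    linear_combination (algebraMap (LXY n) (FXY n) g) *
      (algebraMap (LXY n) (FXY n) (qh n ^ (-2 : ℤ) : (LXY n)ˣ) - 1) * h1'
  constructor
  · intro h
    rw [← h, ← map_one (algebraMap (LXY n) (FXY n)), ← map_sub, ← map_mul] at key
    exact hinj key
  · intro h
    refine mul_left_cancel₀ hne ?_
    rw [key, ← h, map_mul, map_sub, map_one]

/-- The inverse of the recursion operator. -/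
lemma StepRel.reverse {g h : LXY n} (H : StepRel u hi h g) :
    (1 - (rootMonomial hi : LXY n)) * h = (qh n : LXY n) *
      (((qh n ^ (-2 : ℤ) : (LXY n)ˣ) - 1 : LXY n) * (rootMonomial hi : LXY n) * g +
        (rootMonomial hi - (qh n ^ (-2 : ℤ) : (LXY n)ˣ) : LXY n) * (shiftMonomial u hi : LXY n) *
          permX (simpleRefl i hi) g) := by
  -- Since `s_i` inverts both monomials, its image of `H` is a second linear relation among `g`, `h`
  -- and their images under `s_i`. Eliminating `s_i h` and using `q t = 1` (this is `r3`) expresses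
  -- `h` through `g` and `s_i g`.
  have Hs := congrArg (permX (simpleRefl i hi)) H
  have e1 := congrArg Units.val (permX_rootMonomial hi)
  have e2 := congrArg Units.val (permX_shiftMonomial u hi)
  have e3 := congrArg Units.val (permX_qh (simpleRefl i hi))
  have e4 := congrArg Units.val (map_zpow (Units.map (permX (simpleRefl i hi) : LXY n →* LXY n))
    (qh n) (-2))
  rw [permX_qh] at e4
  simp only [Units.coe_map, MonoidHom.coe_coe] at e1 e2 e3 e4
  simp only [map_mul, map_sub, map_add, map_one, e1, e2, e3, e4, permX_permX, simpleRefl_mul_self,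
    permX_one] at Hs
  unfold StepRel at H
  have r1 : (rootMonomial hi : LXY n) * ((rootMonomial hi)⁻¹ : (LXY n)ˣ) = 1 := Units.mul_inv _
  have r2 : (shiftMonomial u hi : LXY n) * ((shiftMonomial u hi)⁻¹ : (LXY n)ˣ) = 1 :=
    Units.mul_inv _
  have r3 : (qh n : LXY n) * (qh n : LXY n) * ((qh n ^ (-2 : ℤ) : (LXY n)ˣ) : LXY n) = 1 := by
    rw [← Units.val_mul, ← Units.val_mul, ← sq, ← zpow_natCast, ← zpow_add]
    simp
  refine mul_left_cancel₀ (one_sub_rootMonomial_ne_zero hi) ?_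
  generalize (rootMonomial hi : LXY n) = X at *
  generalize (((rootMonomial hi)⁻¹ : (LXY n)ˣ) : LXY n) = X' at *
  generalize (shiftMonomial u hi : LXY n) = m at *
  generalize (((shiftMonomial u hi)⁻¹ : (LXY n)ˣ) : LXY n) = m' at *
  generalize ((qh n ^ (-2 : ℤ) : (LXY n)ˣ) : LXY n) = t at *
  generalize (qh n : LXY n) = q at *
  generalize permX (simpleRefl i hi) g = sg at *
  generalize permX (simpleRefl i hi) h = sh at *
  linear_combination -q * (t - 1) * X * H + q * (X - t) * m * X * Hs +
    (q * (X - t) * m * sg + q ^ 2 * (X - t) * h) * r1 +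
    q ^ 2 * (X - t) * X * (X' - t) * h * r2 - (1 - X) ^ 2 * h * r3

/-- The sum of the two weights is a constant vector, hence fixed by every `s_i`. Up to an invariant
factor, the monomial in the prefactor of `stab` is therefore the inverse of the one conjugating
`τ̄_i`. -/
lemma act_longElt_add (u : Perm (Fin n)) (k : Fin n) :
    act (u * longElt n)⁻¹ (weylVec n) k + twistedRho u k = n - 1 := by
  have h : (longElt n * u⁻¹ * longElt n)⁻¹ = longElt n * (u * longElt n) := by
    simp [mul_inv_rev, longElt_inv, mul_assoc]
  simp only [twistedRho, act, h, inv_inv, weylVec, Perm.mul_apply (longElt n)]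
  rw [longElt_apply, Fin.val_rev]
  have := ((u * longElt n) k).isLt
  push_cast [Nat.sub_sub]
  rw [Nat.cast_sub (by omega)]
  push_cast
  ring

/-- The exchange relation times the prefactor. The drop of the length by one supplies the factor
`q^{1/2}` (`hq`), and moving the prefactor past `s_i` produces the shift monomial (`hA`). -/
theorem stab_stepRel {w : Perm (Fin n)} (hw : w ⟨i + 1, hi⟩ < w ⟨i, Nat.lt_of_succ_lt hi⟩) :
    StepRel u hi (stab u w) (stab u (w * simpleRefl i hi)) := by
  have hlen : len w = len (w * simpleRefl i hi) + 1 := by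
    have := len_mul_simpleRefl_of_lt hi (w * simpleRefl i hi)
      (by simpa [simpleRefl_left, simpleRefl_right])
    rwa [mul_simpleRefl_mul_simpleRefl] at this
  have hq : (qh n ^ (2 * (len (longElt n) : ℤ) - (len (w * simpleRefl i hi) : ℤ)) : (LXY n)ˣ) =
      qh n * qh n ^ (2 * (len (longElt n) : ℤ) - (len w : ℤ)) := by
    rw [hlen, ← zpow_one_add]
    congr 1
    push_cast
    ring
  have hA : (shiftMonomial u hi) * Units.map (permX (simpleRefl i hi) : LXY n →* LXY n)
      (rFactor (fun i => xv ((u * longElt n)⁻¹ i)) (fun j => yv (u j))) =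
      rFactor (fun i => xv ((u * longElt n)⁻¹ i)) (fun j => yv (u j)) := by
    have h1 : corootPairing i hi (act (u * longElt n)⁻¹ (weylVec n)) =
        -corootPairing i hi (twistedRho u) := by
      have h1 := act_longElt_add u ⟨i, Nat.lt_of_succ_lt hi⟩
      have h2 := act_longElt_add u ⟨i + 1, hi⟩
      unfold corootPairing
      linarith
    have h2 : Units.map (permX (simpleRefl i hi) : LXY n →* LXY n) (-1) = -1 := by ext1; simp
    have hshift : shiftMonomial u hi * monomial xv
        (act (simpleRefl i hi) (act (u * longElt n)⁻¹ (weylVec n))) =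
        monomial xv (act (u * longElt n)⁻¹ (weylVec n)) := by
      rw [act_simpleRefl, h1, neg_neg, shiftMonomial, ← monomial_add]
      congr 1
      rw [neg_smul]
      abel
    simp only [rFactor]
    rw [map_mul, map_mul, map_pow, h2, monomial_comp, map_permX_monomial, map_monomial (φ := _)
      (fun j => yv (u j))]
    simp only [permX_yv]
    conv_rhs => rw [← hshift]
    ac_rfl
  have hZ := partitionFn_exchange_of_isDomain (R := LXY n)
    (t := ((qh n ^ (-2 : ℤ) : (LXY n)ˣ) : LXY n)) (Units.ne_zero _)
    (fun i => (xv i)⁻¹) (fun j => (yv (u j))⁻¹) u w hi hw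
    (fun h => simpleIndex_ne hi (xv_injective (inv_injective h)))
  have ht : permX (simpleRefl i hi) ((qh n ^ (-2 : ℤ) : (LXY n)ˣ) : LXY n) =
      ((qh n ^ (-2 : ℤ) : (LXY n)ˣ) : LXY n) := by
    have := congrArg Units.val (map_zpow (Units.map (permX (simpleRefl i hi) : LXY n →* LXY n))
      (qh n) (-2))
    rw [permX_qh] at this
    exact this
  have hsZ : permX (simpleRefl i hi) (partitionFn ((qh n ^ (-2 : ℤ) : (LXY n)ˣ) : LXY n)
      (fun i => (xv i)⁻¹) (fun j => (yv (u j))⁻¹) u w) =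
      partitionFn ((qh n ^ (-2 : ℤ) : (LXY n)ˣ) : LXY n)
      (fun k => (xv (simpleRefl i hi k))⁻¹) (fun j => (yv (u j))⁻¹) u w := by
    rw [map_partitionFn]
    simp only [map_inv, permX_xv, permX_yv]
    rw [ht]
  have hsq := congrArg Units.val (map_zpow (Units.map (permX (simpleRefl i hi) : LXY n →* LXY n))
    (qh n) (2 * (len (longElt n) : ℤ) - (len w : ℤ)))
  rw [permX_qh] at hsq
  have hA' := congrArg Units.val hA
  simp only [Units.coe_map, MonoidHom.coe_coe, Units.val_mul] at hsq hA'
  unfold StepRel stab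
  rw [hq]
  simp only [map_mul, map_pow, map_neg, map_one, hsZ, hsq, Units.val_mul]
  rw [rootMonomial_eq]
  -- The relation `hZ` is in the inverted variables; multiplied by `x_{i+1}`, its coefficients
  -- become `1 - x^{-α_i}`, `t - 1` and `x^{-α_i} - t`.
  have hx1 : (xv ⟨i + 1, hi⟩ : LXY n) * ((xv ⟨i + 1, hi⟩)⁻¹ : (LXY n)ˣ) = 1 := Units.mul_inv _
  simp only [Units.val_mul]
  generalize partitionFn ((qh n ^ (-2 : ℤ) : (LXY n)ˣ) : LXY n)
    (fun i => (xv i)⁻¹) (fun j => (yv (u j))⁻¹) u w = Z at *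
  generalize partitionFn ((qh n ^ (-2 : ℤ) : (LXY n)ˣ) : LXY n)
    (fun i => (xv i)⁻¹) (fun j => (yv (u j))⁻¹) u (w * simpleRefl i hi) = Z₁ at *
  generalize partitionFn ((qh n ^ (-2 : ℤ) : (LXY n)ˣ) : LXY n)
    (fun k => (xv (simpleRefl i hi k))⁻¹) (fun j => (yv (u j))⁻¹) u w = Z₂ at *
  generalize ((qh n ^ (-2 : ℤ) : (LXY n)ˣ) : LXY n) = t at *
  generalize ((qh n ^ (2 * (len (longElt n) : ℤ) - (len w : ℤ)) : (LXY n)ˣ) : LXY n) = Q at *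
  generalize (qh n : LXY n) = q at *
  generalize ((rFactor (fun i => xv ((u * longElt n)⁻¹ i)) (fun j => yv (u j)) : (LXY n)ˣ) :
    LXY n) = A at *
  generalize (shiftMonomial u hi : LXY n) = m at *
  generalize ((-1 : LXY n) ^ len (u * longElt n)) = C at *
  generalize (((xv ⟨i, Nat.lt_of_succ_lt hi⟩)⁻¹ : (LXY n)ˣ) : LXY n) = a at *
  generalize (((xv ⟨i + 1, hi⟩)⁻¹ : (LXY n)ˣ) : LXY n) = b at *
  generalize ((xv ⟨i + 1, hi⟩ : (LXY n)ˣ) : LXY n) = x₂ at *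
  linear_combination C * q * Q * A * x₂ * hZ - q * (a * x₂ - t) * C * Q * Z₂ * hA' -
    C * q * Q * A * (Z₁ - (t - 1) * Z + t * Z₂) * hx1

end Recursion

/-! ### The base value -/

section Base

variable {n : ℕ}

/-- The pairs `(i, j)` with `i + j ≤ n`, for indices starting from `1`. -/
def staircase (n : ℕ) : Finset (Fin n × Fin n) :=
  Finset.univ.filter fun p : Fin n × Fin n => ((p.1 : ℕ) + 1) + ((p.2 : ℕ) + 1) ≤ n

lemma mem_staircase {p : Fin n × Fin n} : p ∈ staircase n ↔ (p.1 : ℕ) + p.2 + 2 ≤ n := by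
  simp only [staircase, Finset.mem_filter, Finset.mem_univ, true_and]
  omega

lemma prod_staircase {M : Type*} [CommMonoid M] (f : Fin n → Fin n → M) :
    ∏ p ∈ staircase n, f p.1 p.2 =
      ∏ p ∈ Finset.univ.filter (fun p : Fin n × Fin n => p.1 < p.2), f p.2.rev p.1 := by
  refine Finset.prod_nbij' (fun p => (p.2, p.1.rev)) (fun p => (p.2.rev, p.1)) ?_ ?_ ?_ ?_ ?_
  · rintro ⟨p, q⟩ h
    have := mem_staircase.1 h
    simp only [Finset.mem_filter, Finset.mem_univ, true_and, Fin.lt_def, Fin.val_rev] at this ⊢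
    omega
  · rintro ⟨p, q⟩ h
    refine mem_staircase.2 ?_
    simp only [Finset.mem_filter, Finset.mem_univ, true_and, Fin.lt_def, Fin.val_rev] at h ⊢
    omega
  · rintro ⟨p, q⟩ _; simp
  · rintro ⟨p, q⟩ _; simp
  · rintro ⟨p, q⟩ _; simp

lemma card_staircase (n : ℕ) : (staircase n).card = len (longElt n) := by
  have h := prod_staircase (n := n) (M := Multiplicative ℕ) fun _ _ => Multiplicative.ofAdd 1
  simp only [Finset.prod_const, ← ofAdd_nsmul, smul_eq_mul, mul_one] at h
  rw [Multiplicative.ofAdd.injective h, len_eq]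
  congr 1
  ext p
  simp [mem_inversions, longElt_apply]

lemma monomial_weylVec {R : Type*} [CommRing R] (z : Fin n → Rˣ) :
    monomial z (weylVec n) =
      ∏ p ∈ Finset.univ.filter (fun p : Fin n × Fin n => p.1 < p.2), z p.1 := by
  rw [prod_filter_lt fun i _ => z i, monomial]
  refine Finset.prod_congr rfl fun i _ => ?_
  rw [Finset.prod_const, Fin.card_Ioi, weylVec, ← zpow_natCast]
  congr 1
  have := i.isLt
  omega

lemma prod_staircase_snd {R : Type*} [CommRing R] (z : Fin n → Rˣ) :
    ∏ p ∈ staircase n, z p.2 = monomial z (weylVec n) := by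
  rw [prod_staircase fun _ j => z j, monomial_weylVec]

lemma prod_staircase_fst {R : Type*} [CommRing R] (z : Fin n → Rˣ) :
    ∏ p ∈ staircase n, z p.1 = monomial z (weylVec n) := by
  rw [← prod_staircase_snd]
  refine Finset.prod_nbij' Prod.swap Prod.swap ?_ ?_ ?_ ?_ ?_
  · intro p h; rw [mem_staircase] at *; simp only [Prod.fst_swap, Prod.snd_swap]; omega
  · intro p h; rw [mem_staircase] at *; simp only [Prod.fst_swap, Prod.snd_swap]; omega
  all_goals intros; simp

theorem stab_mul_longElt (u : Perm (Fin n)) : stab u (u * longElt n) = baseValue u := by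
  rw [stab, baseValue, partitionFn_mul_longElt]
  change _ * (_ * ∏ p ∈ staircase n, _) = _ * ∏ p ∈ staircase n, _
  -- Each factor is `1 - y/x = -(y/x) (1 - x/y)`. Rows and columns of the staircase have the lengths
  -- given by `ρ`, so the monomials collect to `x^{-ρ} y_u^ρ`, which turns `r(·; y_u)` into `r(·;
  -- x)`.
  have hprod : ∏ p ∈ staircase n, (1 - (((xv p.1)⁻¹ * ((yv (u p.2))⁻¹)⁻¹ : (LXY n)ˣ) : LXY n)) =
      (((-1) ^ len (longElt n) * (monomial xv (weylVec n))⁻¹ *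
        monomial (fun j => yv (u j)) (weylVec n) : (LXY n)ˣ) : LXY n) *
      ∏ p ∈ staircase n, (1 - ((xv p.1 * (yv (u p.2))⁻¹ : (LXY n)ˣ) : LXY n)) := by
    rw [← prod_staircase_snd fun j => yv (u j), ← monomial_inv, ← prod_staircase_fst,
      ← card_staircase, ← Finset.prod_const, ← Finset.prod_mul_distrib, ← Finset.prod_mul_distrib,
      Units.coe_prod, ← Finset.prod_mul_distrib]
    refine Finset.prod_congr rfl fun p _ => ?_
    rw [mul_sub, mul_one, ← Units.val_mul]
    have : (-1 * (xv p.1)⁻¹ * yv (u p.2)) * (xv p.1 * (yv (u p.2))⁻¹) = (-1 : (LXY n)ˣ) := by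
      rw [mul_mul_mul_comm, inv_mul_cancel_right, mul_inv_cancel, mul_one]
    rw [this, inv_inv]
    push_cast
    ring
  rw [hprod]
  have hU : (-1) ^ len (u * longElt n) *
      qh n ^ (2 * (len (longElt n) : ℤ) - (len (u * longElt n) : ℤ)) *
      rFactor (fun i => xv ((u * longElt n)⁻¹ i)) (fun j => yv (u j)) *
      ((qh n ^ (-2 : ℤ)) ^ len u * ((-1) ^ len (longElt n) * (monomial xv (weylVec n))⁻¹ *
        monomial (fun j => yv (u j)) (weylVec n))) =
      (-1) ^ len u * qh n ^ len (u * longElt n) *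
        rFactor (fun i => xv ((u * longElt n)⁻¹ i)) xv := by
    have h1 := len_longElt u
    have hq : qh n ^ (2 * (len (longElt n) : ℤ) - (len (u * longElt n) : ℤ)) *
        (qh n ^ (-2 : ℤ)) ^ len u = qh n ^ len (u * longElt n) := by
      rw [← zpow_natCast, ← zpow_natCast, ← zpow_mul, ← zpow_add, h1]
      congr 1
      push_cast
      ring
    have hs : (-1 : (LXY n)ˣ) ^ len (u * longElt n) * (-1) ^ len (longElt n) = (-1) ^ len u := by
      rw [h1, add_comm, pow_add, ← mul_assoc, ← mul_pow]; simp
    rw [← hq, ← hs, rFactor, rFactor, monomial_neg, monomial_neg]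
    generalize monomial (fun j => yv (u j)) (weylVec n) = a
    rw [show ∀ (b c d e f g h i : (LXY n)ˣ), b * c * (d * e * f⁻¹) * (g * (h * i * f)) =
      b * c * (d * e * (g * (h * i))) from fun b c d e f g h i => by
        simp only [mul_assoc, mul_left_comm f⁻¹]
        simp]
    ac_rfl
  have hU' := congrArg Units.val hU
  push_cast at hU' ⊢
  linear_combination (∏ p ∈ staircase n, (1 - (xv p.1 : LXY n) * ((yv (u p.2))⁻¹ : (LXY n)ˣ))) * hU'

/-- The product `∏_{j < k} (z_j - z_k)`. -/
def vandermondeProd {R : Type*} [CommRing R] (z : Fin n → R) : R :=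
  ∏ p ∈ Finset.univ.filter (fun p : Fin n × Fin n => p.1 < p.2), (z p.1 - z p.2)

lemma vandermondeProd_comp {R : Type*} [CommRing R] (z : Fin n → R) (w : Perm (Fin n)) :
    vandermondeProd (fun k => z (w k)) = (-1) ^ len w * vandermondeProd z :=
  prod_filter_lt_comp w (f := fun i j => z i - z j) (by simp)

lemma prod_one_sub_div {R : Type*} [CommRing R] (z : Fin n → Rˣ) :
    ∏ p ∈ Finset.univ.filter (fun p : Fin n × Fin n => p.1 < p.2),
      (1 - ((z p.2 * (z p.1)⁻¹ : Rˣ) : R)) =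
    ((monomial z (weylVec n))⁻¹ : Rˣ) * vandermondeProd (fun k => (z k : R)) := by
  rw [monomial_weylVec, ← Finset.prod_inv_distrib, Units.coe_prod, vandermondeProd,
    ← Finset.prod_mul_distrib]
  refine Finset.prod_congr rfl fun p _ => ?_
  rw [mul_sub, Units.inv_mul, Units.val_mul, mul_comm]

/-- The exponent `ρ + w₀ ρ` is constant, so the result is symmetric in the variables. This allows
`y_u` to be replaced by `y` when the monomials are compared. -/
lemma monomial_weylVec_mul_rev {R : Type*} [CommRing R] (z : Fin n → Rˣ) :
    monomial z (weylVec n) * monomial (fun k => z k.rev) (weylVec n) =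
      ∏ k, z k ^ ((n : ℤ) - 1) := by
  have h : (fun k => z k.rev) = fun k => z (longElt n k) := rfl
  rw [h, monomial_comp, ← monomial_add, monomial]
  refine Finset.prod_congr rfl fun k _ => ?_
  congr 1
  have := k.isLt
  simp only [Pi.add_apply, weylVec, act, longElt_inv, longElt_apply, Fin.val_rev]
  omega

lemma prod_one_sub_div_rev {R : Type*} [CommRing R] (z : Fin n → Rˣ) :
    ∏ p ∈ Finset.univ.filter (fun p : Fin n × Fin n => p.1 < p.2),
      (1 - ((z p.1 * (z p.2)⁻¹ : Rˣ) : R)) =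
    ((monomial (fun k => z k.rev) (weylVec n))⁻¹ : Rˣ) * ((-1) ^ len (longElt n) *
      vandermondeProd (fun k => (z k : R))) := by
  have h := prod_one_sub_div fun k => z k.rev
  have h2 : vandermondeProd (fun k : Fin n => (z k.rev : R)) = _ :=
    vandermondeProd_comp (fun k => (z k : R)) (longElt n)
  rw [h2] at h
  rw [← h]
  refine Finset.prod_nbij' (fun p => (p.2.rev, p.1.rev)) (fun p => (p.2.rev, p.1.rev))
    ?_ ?_ ?_ ?_ ?_
  · rintro ⟨p, q⟩ h; simpa using h
  · rintro ⟨p, q⟩ h; simpa using h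
  · rintro ⟨p, q⟩ _; simp
  · rintro ⟨p, q⟩ _; simp
  · rintro ⟨p, q⟩ _; simp

lemma restrict_baseValue (u v : Perm (Fin n)) :
    restrict v (baseValue u) = (-1) ^ len u * (qhY n : LY n) ^ len (u * longElt n) *
      (rFactor (fun i => yY (v ((u * longElt n)⁻¹ i))) (fun i => yY (v i)) : (LY n)ˣ) *
      ∏ p ∈ staircase n, (1 - ((yY (v p.1) * (yY (u p.2))⁻¹ : (LY n)ˣ) : LY n)) := by
  have hq := congrArg Units.val (restrict_qh v)
  have hr : Units.map (restrict v : LXY n →* LY n)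
      (rFactor (fun i => xv ((u * longElt n)⁻¹ i)) xv) =
      rFactor (fun i => yY (v ((u * longElt n)⁻¹ i))) (fun i => yY (v i)) := by
    have h2 : Units.map (restrict v : LXY n →* LY n) (-1) = -1 := by ext1; simp
    simp only [rFactor, map_mul, map_pow, h2, map_monomial, restrict_xv]
  have hr' := congrArg Units.val hr
  have hp : ∀ p : Fin n × Fin n, restrict v ((xv p.1 * (yv (u p.2))⁻¹ : (LXY n)ˣ) : LXY n) =
      ((yY (v p.1) * (yY (u p.2))⁻¹ : (LY n)ˣ) : LY n) := by
    intro p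
    rw [← restrict_xv, ← restrict_yv v, ← map_inv, ← map_mul]
    rfl
  simp only [Units.coe_map, MonoidHom.coe_coe] at hq hr'
  simp only [baseValue, map_mul, map_pow, map_neg, map_one, map_prod, map_sub, hq, hr', hp]
  rfl

/-- At `v = u w₀` the base product becomes the product of `1 - y_{u(q)} / y_{u(p)}` over `p < q`. Up
to a monomial this is the Vandermonde product in `y_u`. Its sign relative to the one in `y` is
`(-1)^{ℓ(u)}`, which cancels the sign of the base value. -/
theorem restrict_stab_mul_longElt (u : Perm (Fin n)) :
    restrict (u * longElt n) (stab u (u * longElt n)) =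
      (qhY n : LY n) ^ len (u * longElt n)
        * ∏ p ∈ Finset.univ.filter (fun p : Fin n × Fin n => p.1 < p.2),
            (1 - ((monomial yY (root p.1 p.2) : (LY n)ˣ) : LY n)) := by
  simp only [stab_mul_longElt, restrict_baseValue, monomial_root, prod_one_sub_div_rev]
  rw [prod_staircase (fun i j => 1 - ((yY ((u * longElt n) i) * (yY (u j))⁻¹ : (LY n)ˣ) : LY n))]
  have h1 : ∀ j : Fin n, (u * longElt n) j.rev = u j := fun j => by simp [longElt_apply]
  have h2 : ∀ j : Fin n, (u * longElt n) ((u * longElt n)⁻¹ j) = j :=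
    fun j => (u * longElt n).apply_symm_apply j
  simp only [h1, h2]
  rw [prod_one_sub_div (fun k => yY (u k)),
    vandermondeProd_comp (fun k => ((yY k : (LY n)ˣ) : LY n)) u, rFactor, monomial_neg]
  have e1 := monomial_weylVec_mul_rev (n := n) yY
  have e2 := monomial_weylVec_mul_rev (n := n) (fun k => yY (u k))
  rw [Equiv.prod_comp u fun k => yY k ^ ((n : ℤ) - 1), ← e1] at e2
  have e3 : (fun i => yY ((u * longElt n) i)) = fun k => yY (u k.rev) := rfl
  rw [e3]
  set a := monomial yY (weylVec n)
  set b := monomial (fun k => yY (u k.rev)) (weylVec n)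
  set c := monomial (fun k => yY (u k)) (weylVec n)
  set d := monomial (fun k : Fin n => yY k.rev) (weylVec n)
  have e4 : a * b⁻¹ * c⁻¹ = d⁻¹ := by
    rw [mul_assoc, ← mul_inv, mul_comm b, e2, mul_inv, mul_inv_cancel_left]
  have e5 := congrArg Units.val e4
  have e6 : ((-1 : LY n) ^ len u) * (-1) ^ len u = 1 := by rw [← mul_pow]; simp
  push_cast at e5 ⊢
  linear_combination (qhY n : LY n) ^ len (u * longElt n) * (-1) ^ len (longElt n) *
    vandermondeProd (fun k => ((yY k : (LY n)ˣ) : LY n)) * e5 +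
    (qhY n : LY n) ^ len (u * longElt n) * (-1) ^ len (longElt n) *
    vandermondeProd (fun k => ((yY k : (LY n)ˣ) : LY n)) * a * (b⁻¹ : (LY n)ˣ) * (c⁻¹ : (LY n)ˣ) * e6

end Base

/-! ### Uniqueness, restrictions and vanishing -/

section Restrictions

variable {n : ℕ} (u : Perm (Fin n)) {i : ℕ} (hi : i + 1 < n)

/-- Descending from the long element in `a = u⁻¹ w` reaches every `w`, but the length of `u a` may
go up or down along the way; upward steps use the inverted recursion. -/
lemma eq_stab_of_recursion (F : Perm (Fin n) → LXY n)
    (hF : F (u * longElt n) = baseValue u)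
    (hrec : ∀ (w : Perm (Fin n)) (i : ℕ) (hi : i + 1 < n),
      w ⟨i + 1, hi⟩ < w ⟨i, Nat.lt_of_succ_lt hi⟩ →
        StepRel u hi (F w) (F (w * simpleRefl i hi))) :
    F = stab u := by
  suffices h : ∀ a : Perm (Fin n), F (u * a) = stab u (u * a) by
    funext w
    simpa using h (u⁻¹ * w)
  intro a
  induction a using longElt_induction with
  | base => rw [hF, stab_mul_longElt]
  | step a i hi _ ih =>
    rw [← mul_assoc]
    refine mul_left_cancel₀ (one_sub_rootMonomial_ne_zero hi) ?_
    rcases lt_or_gt_of_ne ((u * a).injective.ne (simpleIndex_ne hi)) with h | h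
    · have hs : (u * a * simpleRefl i hi) ⟨i + 1, hi⟩ <
          (u * a * simpleRefl i hi) ⟨i, Nat.lt_of_succ_lt hi⟩ := by
        rwa [Perm.mul_apply _ (simpleRefl i hi), Perm.mul_apply _ (simpleRefl i hi),
          simpleRefl_left, simpleRefl_right]
      have h1 := hrec _ i hi hs
      have h2 := stab_stepRel u hi hs
      rw [mul_simpleRefl_mul_simpleRefl] at h1 h2
      rw [h1.reverse, h2.reverse, ih]
    · have h1 := hrec _ i hi h
      have h2 := stab_stepRel u hi h
      unfold StepRel at h1 h2
      rw [h1, h2, ih]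

lemma restrict_rootMonomial (v : Perm (Fin n)) :
    Units.map (restrict v : LXY n →* LY n) (rootMonomial hi) =
      monomial yY (-act v (simpleRoot i hi)) := by
  rw [rootMonomial, map_monomial, ← act_neg, ← monomial_comp]
  simp only [restrict_xv]

lemma restrict_shiftMonomial (v : Perm (Fin n)) :
    Units.map (restrict v : LXY n →* LY n) (shiftMonomial u hi) =
      monomial yY (-corootPairing i hi (twistedRho u) • act v (simpleRoot i hi)) := by
  rw [shiftMonomial, map_monomial, ← act_zsmul, ← monomial_comp]
  simp only [restrict_xv]

lemma one_sub_monomial_act_ne_zero (v : Perm (Fin n)) :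
    1 - ((monomial yY (-act v (simpleRoot i hi)) : (LY n)ˣ) : LY n) ≠ 0 := by
  intro h
  have h1 : monomial yY (-act v (simpleRoot i hi)) = 1 := Units.ext (sub_eq_zero.1 h).symm
  rw [simpleRoot, act_root, monomial_neg, monomial_root, inv_eq_one, mul_inv_eq_one] at h1
  exact simpleIndex_ne hi (v.injective (yY_injective h1))

lemma restrict_qh_zpow (v : Perm (Fin n)) (k : ℤ) :
    restrict v ((qh n ^ k : (LXY n)ˣ) : LXY n) = ((qhY n ^ k : (LY n)ˣ) : LY n) := by
  have := congrArg Units.val (map_zpow (Units.map (restrict v : LXY n →* LY n)) (qh n) k)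
  rw [restrict_qh] at this
  exact this

/-- The restriction of the recursion from `w` to a shorter `w s_i`, without denominators. -/
lemma restrict_stab_of_gt {w : Perm (Fin n)} (v : Perm (Fin n))
    (hw : w ⟨i + 1, hi⟩ < w ⟨i, Nat.lt_of_succ_lt hi⟩) :
    (1 - ((monomial yY (-act v (simpleRoot i hi)) : (LY n)ˣ) : LY n)) *
        restrict v (stab u (w * simpleRefl i hi)) =
      (qhY n : LY n) * (((qhY n ^ (-2 : ℤ) : (LY n)ˣ) - 1 : LY n) * restrict v (stab u w) +
        ((monomial yY (-act v (simpleRoot i hi)) : (LY n)ˣ) - (qhY n ^ (-2 : ℤ) : (LY n)ˣ) : LY n) *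
        (monomial yY (-corootPairing i hi (twistedRho u) • act v (simpleRoot i hi)) : (LY n)ˣ) *
        restrict (v * simpleRefl i hi) (stab u w)) := by
  have h := congrArg (restrict v) (stab_stepRel u hi hw)
  have e1 := congrArg Units.val (restrict_rootMonomial hi v)
  have e2 := congrArg Units.val (restrict_shiftMonomial u hi v)
  have e3 := congrArg Units.val (restrict_qh v)
  simp only [Units.coe_map, MonoidHom.coe_coe] at e1 e2 e3
  simpa only [map_mul, map_sub, map_add, map_one, e1, e2, e3, restrict_qh_zpow, restrict_permX]
    using h

/-- The restriction of the recursion from `w` to a longer `w s_i`, without denominators. -/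
lemma restrict_stab_of_lt {w : Perm (Fin n)} (v : Perm (Fin n))
    (hw : w ⟨i, Nat.lt_of_succ_lt hi⟩ < w ⟨i + 1, hi⟩) :
    (1 - ((monomial yY (-act v (simpleRoot i hi)) : (LY n)ˣ) : LY n)) *
        restrict v (stab u (w * simpleRefl i hi)) =
      (qhY n : LY n) * (((qhY n ^ (-2 : ℤ) : (LY n)ˣ) - 1 : LY n) *
        (monomial yY (-act v (simpleRoot i hi)) : (LY n)ˣ) * restrict v (stab u w) +
        ((monomial yY (-act v (simpleRoot i hi)) : (LY n)ˣ) - (qhY n ^ (-2 : ℤ) : (LY n)ˣ) : LY n) *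
        (monomial yY (-corootPairing i hi (twistedRho u) • act v (simpleRoot i hi)) : (LY n)ˣ) *
        restrict (v * simpleRefl i hi) (stab u w)) := by
  have hs : (w * simpleRefl i hi) ⟨i + 1, hi⟩ <
      (w * simpleRefl i hi) ⟨i, Nat.lt_of_succ_lt hi⟩ := by
    rwa [Perm.mul_apply, Perm.mul_apply, simpleRefl_left, simpleRefl_right]
  have h0 := stab_stepRel u hi hs
  rw [mul_simpleRefl_mul_simpleRefl] at h0
  have h := congrArg (restrict v) h0.reverse
  have e1 := congrArg Units.val (restrict_rootMonomial hi v)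
  have e2 := congrArg Units.val (restrict_shiftMonomial u hi v)
  have e3 := congrArg Units.val (restrict_qh v)
  simp only [Units.coe_map, MonoidHom.coe_coe] at e1 e2 e3
  simpa only [map_mul, map_sub, map_add, map_one, e1, e2, e3, restrict_qh_zpow, restrict_permX]
    using h

/-- Both sides of the inequalities have the same sum over `k`, so all of them are equalities. -/
lemma perm_eq_longElt_of_forall_le (b : Perm (Fin n)) (h : ∀ k : Fin n, k.rev ≤ b k) :
    b = longElt n := by
  have hsum : ∑ k : Fin n, ((k.rev : Fin n) : ℕ) = ∑ k, ((b k : Fin n) : ℕ) := by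
    rw [Equiv.sum_comp b fun k : Fin n => (k : ℕ)]
    exact Equiv.sum_comp Fin.revPerm fun k : Fin n => (k : ℕ)
  have := (Finset.sum_eq_sum_iff_of_le fun k _ => Fin.le_def.1 (h k)).1 hsum
  ext k
  exact (this k (Finset.mem_univ k)).symm

/-- If `a s_i < a` and `a s_i` is not below `b = u⁻¹ v`, then by lifting `a` is below neither `b`
nor `b s_i`. Both terms of the recurrence for the restriction at `v` then vanish by induction,
whichever of its two forms applies. -/
theorem restrict_stab_eq_zero (v w : Perm (Fin n)) (h : ¬ TwistedBruhatLE u w v) :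
    restrict v (stab u w) = 0 := by
  suffices H : ∀ a v : Perm (Fin n), ¬ BruhatLE a (u⁻¹ * v) → restrict v (stab u (u * a)) = 0 by
    simpa using H (u⁻¹ * w) v h
  intro a
  induction a using longElt_induction with
  | base =>
    intro v hv
    rw [stab_mul_longElt, restrict_baseValue]
    -- For such a `k`, the pair `(k, (u⁻¹ v)(k))` lies in the staircase, and its factor restricts to
    -- `1 - y_{v(k)} / y_{v(k)} = 0`.
    obtain ⟨k, hk⟩ : ∃ k : Fin n, (u⁻¹ * v) k < k.rev := by
      by_contra! hc
      exact hv (by rw [perm_eq_longElt_of_forall_le _ hc]; exact .refl)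
    refine mul_eq_zero_of_right _ (Finset.prod_eq_zero (i := (k, (u⁻¹ * v) k)) ?_ ?_)
    · rw [mem_staircase]
      simp only [Fin.lt_def, Fin.val_rev] at hk ⊢
      omega
    · have : u ((u⁻¹ * v) k) = v k := by simp
      simp only [this, mul_inv_cancel, Units.val_one, sub_self]
  | step a i hi ha ih =>
    intro v hv
    have h1 : restrict v (stab u (u * a)) = 0 :=
      ih v fun h => hv (bruhatLE_of_bruhatLE_mul_simpleRefl hi ha (.inl h))
    have h2 : restrict (v * simpleRefl i hi) (stab u (u * a)) = 0 :=
      ih _ fun h => hv (bruhatLE_of_bruhatLE_mul_simpleRefl hi ha (.inr (by rwa [mul_assoc])))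
    rw [← mul_assoc]
    refine (mul_eq_zero.1 ?_).resolve_left (one_sub_monomial_act_ne_zero hi v)
    rcases lt_or_gt_of_ne ((u * a).injective.ne (simpleIndex_ne hi)) with h | h
    · rw [restrict_stab_of_lt u hi v h, h1, h2]; simp
    · rw [restrict_stab_of_gt u hi v h, h1, h2]; simp

/-! ### The recurrences in the field of fractions -/

lemma yF_act_sub_one_ne_zero (v : Perm (Fin n)) : yF (-act v (simpleRoot i hi)) - 1 ≠ 0 := by
  intro h
  refine one_sub_monomial_act_ne_zero hi v (IsFractionRing.injective (LY n) (FY n) ?_)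
  rw [map_sub, map_one, map_zero]
  exact sub_eq_zero.2 (sub_eq_zero.1 h).symm

lemma qF_ne_zero (n : ℕ) : qF n ≠ 0 := ((qhY n).isUnit.map (algebraMap (LY n) (FY n))).ne_zero

lemma algebraMap_qhY_zpow (n : ℕ) :
    algebraMap (LY n) (FY n) ((qhY n ^ (-2 : ℤ) : (LY n)ˣ) : LY n) = (qF n ^ 2)⁻¹ := by
  refine eq_inv_of_mul_eq_one_left ?_
  rw [qF, ← map_pow, ← map_mul, ← Units.val_pow_eq_pow_val, ← Units.val_mul, ← zpow_natCast,
    ← zpow_add]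
  simp

lemma stabRes_def (u w v : Perm (Fin n)) :
    stabRes u w v = algebraMap (LY n) (FY n) (restrict v (stab u w)) := rfl

lemma yF_def (μ : Weight n) : yF μ = algebraMap (LY n) (FY n) (monomial yY μ : (LY n)ˣ) := rfl

lemma qF_def (n : ℕ) : qF n = algebraMap (LY n) (FY n) (qhY n) := rfl

theorem stabRes_of_gt {w : Perm (Fin n)} (v : Perm (Fin n))
    (hw : w ⟨i + 1, hi⟩ < w ⟨i, Nat.lt_of_succ_lt hi⟩) :
    stabRes u (w * simpleRefl i hi) v =
      (qF n - (qF n)⁻¹) / (yF (-act v (simpleRoot i hi)) - 1) * stabRes u w v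
      - (qF n * yF (-act v (simpleRoot i hi)) - (qF n)⁻¹)
          / (yF (-act v (simpleRoot i hi)) - 1)
        * yF (-corootPairing i hi (twistedRho u) • act v (simpleRoot i hi))
        * stabRes u w (v * simpleRefl i hi) := by
  have h := congrArg (algebraMap (LY n) (FY n)) (restrict_stab_of_gt u hi v hw)
  have hY := yF_act_sub_one_ne_zero hi v
  have hq := qF_ne_zero n
  simp only [map_mul, map_sub, map_add, map_one, algebraMap_qhY_zpow] at h
  simp only [← stabRes_def, ← yF_def, ← qF_def] at h
  field_simp at h ⊢
  linear_combination -h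

theorem stabRes_of_lt {w : Perm (Fin n)} (v : Perm (Fin n))
    (hw : w ⟨i, Nat.lt_of_succ_lt hi⟩ < w ⟨i + 1, hi⟩) :
    stabRes u (w * simpleRefl i hi) v =
      (qF n - (qF n)⁻¹) * yF (-act v (simpleRoot i hi))
          / (yF (-act v (simpleRoot i hi)) - 1) * stabRes u w v
      - (qF n * yF (-act v (simpleRoot i hi)) - (qF n)⁻¹)
          / (yF (-act v (simpleRoot i hi)) - 1)
        * yF (-corootPairing i hi (twistedRho u) • act v (simpleRoot i hi))
        * stabRes u w (v * simpleRefl i hi) := by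
  have h := congrArg (algebraMap (LY n) (FY n)) (restrict_stab_of_lt u hi v hw)
  have hY := yF_act_sub_one_ne_zero hi v
  have hq := qF_ne_zero n
  simp only [map_mul, map_sub, map_add, map_one, algebraMap_qhY_zpow] at h
  simp only [← stabRes_def, ← yF_def, ← qF_def] at h
  field_simp at h ⊢
  linear_combination -h

end Restrictions

end

end InterpolatedStab

theorem proposition6p8 (n : ℕ) (u : Perm (Fin n)) :
    -- the base value and the recursion determine the family `stab_u`
    (stab u (u * longElt n) = baseValue u ∧
      (∀ (w : Perm (Fin n)) (i : ℕ) (hi : i + 1 < n),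
        BruhatLT (w * simpleRefl i hi) w →
          algebraMap (LXY n) (FXY n) (stab u (w * simpleRefl i hi)) = opM u i hi (stab u w)) ∧
      (∀ F : Perm (Fin n) → LXY n,
        F (u * longElt n) = baseValue u →
        (∀ (w : Perm (Fin n)) (i : ℕ) (hi : i + 1 < n),
          BruhatLT (w * simpleRefl i hi) w →
            algebraMap (LXY n) (FXY n) (F (w * simpleRefl i hi)) = opM u i hi (F w)) →
        F = stab u)) ∧
    -- vanishing of the restrictions
    (∀ v w : Perm (Fin n), ¬ TwistedBruhatLE u w v → restrict v (stab u w) = 0) ∧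
    -- the restriction of `stab_u(u w₀)` at `u w₀`
    (restrict (u * longElt n) (stab u (u * longElt n)) =
      (qhY n : LY n) ^ len (u * longElt n)
        * ∏ p ∈ Finset.univ.filter (fun p : Fin n × Fin n => p.1 < p.2),
            (1 - ((monomial yY (root p.1 p.2) : (LY n)ˣ) : LY n))) ∧
    -- the recurrence of the restrictions when `w s_i < w`
    (∀ (v w : Perm (Fin n)) (i : ℕ) (hi : i + 1 < n),
      BruhatLT (w * simpleRefl i hi) w →
        stabRes u (w * simpleRefl i hi) v =
          (qF n - (qF n)⁻¹) / (yF (-act v (simpleRoot i hi)) - 1) * stabRes u w v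
          - (qF n * yF (-act v (simpleRoot i hi)) - (qF n)⁻¹)
              / (yF (-act v (simpleRoot i hi)) - 1)
            * yF (-corootPairing i hi (twistedRho u) • act v (simpleRoot i hi))
            * stabRes u w (v * simpleRefl i hi)) ∧
    -- the recurrence of the restrictions when `w s_i > w`
    (∀ (v w : Perm (Fin n)) (i : ℕ) (hi : i + 1 < n),
      BruhatLT w (w * simpleRefl i hi) →
        stabRes u (w * simpleRefl i hi) v =
          (qF n - (qF n)⁻¹) * yF (-act v (simpleRoot i hi))
              / (yF (-act v (simpleRoot i hi)) - 1) * stabRes u w v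
          - (qF n * yF (-act v (simpleRoot i hi)) - (qF n)⁻¹)
              / (yF (-act v (simpleRoot i hi)) - 1)
            * yF (-corootPairing i hi (twistedRho u) • act v (simpleRoot i hi))
            * stabRes u w (v * simpleRefl i hi)) := by
  refine ⟨⟨stab_mul_longElt u, fun w i hi hw => ?_, fun F hF hrec => ?_⟩,
    restrict_stab_eq_zero u, restrict_stab_mul_longElt u, fun v w i hi hw => ?_,
    fun v w i hi hw => ?_⟩
  · exact (algebraMap_eq_opM_iff u hi _ _).2
      (stab_stepRel u hi ((bruhatLT_of_mul_simpleRefl_iff hi w).1 hw))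
  · exact eq_stab_of_recursion u F hF fun w i hi hw => (algebraMap_eq_opM_iff u hi _ _).1
      (hrec w i hi ((bruhatLT_of_mul_simpleRefl_iff hi w).2 hw))
  · exact stabRes_of_gt u hi v ((bruhatLT_of_mul_simpleRefl_iff hi w).1 hw)
  · exact stabRes_of_lt u hi v ((bruhatLT_mul_simpleRefl_iff hi w).1 hw)
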